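/- Let $\mathbb D$, $\mathbb T$ and $\mathbb E$ denote the open unit disk, the unit circle and the complement of the closed unit disk in $\mathbb C$. Let $\mathfrak p\in\mathbb C[z,w]$ be an irreducible polynomial of bidegree $(n,m)$ (degree $n$ in $z$ and degree $m$ in $w$) that is inner toral, i.e. whose zero set satisfies $Z(\mathfrak p)\subset \mathbb D^2\cup\mathbb T^2\cup\mathbb E^2$, and let $\mathfrak V(\mathfrak p)=Z(\mathfrak p)\cap\mathbb D^2$. A pure $\mathfrak p$-isopair is a pair $V=(S,T)$ of commuting pure isometries on a complex Hilbert space with $\mathfrak p(S,T)=0$, where an isometry $A$ on $\mathcal H$ is pure if $\bigcap_{j} A^j\mathcal H=\{0\}$. Its bimultiplicity is $(\dim\ker S^*,\dim\ker T^*)$. It has rank $\alpha$, a positive integer, if $\dim\big(\ker(S-\lambda)^*\cap\ker(T-\mu)^*\big)=\alpha$ for every $(\lambda,\mu)\in\mathfrak V(\mathfrak p)$ with $\nabla\mathfrak p(\lambda,\mu)\neq 0$. A rank-$\alpha$ admissible triple $(K,P,Q)$ consists of an $\alpha\times m\alpha$ matrix polynomial $Q$ and an $\alpha\times n\alpha$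 matrix polynomial $P$ in $(z,w)$, both of full rank $\alpha$ at some point of $\mathfrak V(\mathfrak p)$, and an $\alpha\times\alpha$ matrix-valued kernel $K$ on $\mathfrak V(\mathfrak p)$ such that \[ \frac{Q(z,w)Q(\zeta,\eta)^*}{1-z\overline{\zeta}}=K((z,w),(\zeta,\eta))=\frac{P(z,w)P(\zeta,\eta)^*}{1-w\overline{\eta}},\qquad (z,w),(\zeta,\eta)\in\mathfrak V(\mathfrak p). \] Let $\mathcal H^2(K)$ be the Hilbert space of $\mathbb C^\alpha$-valued functions on $\mathfrak V(\mathfrak p)$ with reproducing kernel $K$. Theorem. If $V=(S,T)$ is a pure $\mathfrak p$-isopair of finite bimultiplicity $(M,N)$ and of rank $\alpha$, then there is a rank-$\alpha$ admissible triple $(K,P,Q)$ such that multiplication by $z$ and multiplication by $w$ are bounded operators $M_z$, $M_w$ on $\mathcal H^2(K)$ and $V$ is unitarily equivalent to $(M_z,M_w)$: there is a unitary $U:\mathcal H\to\mathcal H^2(K)$, where $\mathcal H$ is the space on which $V$ acts, with $US=M_zU$ and $UT=M_wU$. -/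

import Mathlib

open MvPolynomial
open scoped ComplexConjugate Matrix

/-- The value `p(z,w)` of a polynomial in the two variables `z = X 0` and `w = X 1`. -/
noncomputable def evalAt (x : ℂ × ℂ) : MvPolynomial (Fin 2) ℂ →+* ℂ :=
  MvPolynomial.eval ![x.1, x.2]

/-- `p` is inner toral: its zero set lies in `𝔻² ∪ 𝕋² ∪ 𝔼²`. -/
def IsInnerToral (p : MvPolynomial (Fin 2) ℂ) : Prop :=
  ∀ x : ℂ × ℂ, evalAt x p = 0 →
    (‖x.1‖ < 1 ∧ ‖x.2‖ < 1) ∨ (‖x.1‖ = 1 ∧ ‖x.2‖ = 1) ∨ (1 < ‖x.1‖ ∧ 1 < ‖x.2‖)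

/-- `𝔙(p) = Z(p) ∩ 𝔻²`. -/
def variety (p : MvPolynomial (Fin 2) ℂ) : Set (ℂ × ℂ) :=
  {x | evalAt x p = 0 ∧ ‖x.1‖ < 1 ∧ ‖x.2‖ < 1}

/-- `x` is a regular point for `p`: `p(x) = 0` and `∇p(x) ≠ 0`. -/
def IsRegularPoint (p : MvPolynomial (Fin 2) ℂ) (x : ℂ × ℂ) : Prop :=
  evalAt x p = 0 ∧ (evalAt x (pderiv 0 p) ≠ 0 ∨ evalAt x (pderiv 1 p) ≠ 0)

section Operators

variable {H : Type*} [NormedAddCommGroup H] [InnerProductSpace ℂ H]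

/-- A pure isometry: an isometry `V` with `⋂ⱼ Vʲ(H) = {0}`, i.e. without unitary part. -/
structure IsPureIsometry (V : H →L[ℂ] H) : Prop where
  isometry : ∀ f, ‖V f‖ = ‖f‖
  pure : ∀ f, (∀ j : ℕ, ∃ g, (V ^ j) g = f) → f = 0

/-- `q(S,T) = ∑ q_{ij} Sⁱ Tʲ`. -/
noncomputable def polyEval (q : MvPolynomial (Fin 2) ℂ) (S T : H →L[ℂ] H) : H →L[ℂ] H :=
  ∑ d ∈ q.support, q.coeff d • (S ^ d 0 * T ^ d 1)

/-- A pure `p`-isopair: commuting pure isometries `S`, `T` with `p(S,T) = 0`. -/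
structure IsPureIsopair (p : MvPolynomial (Fin 2) ℂ) (S T : H →L[ℂ] H) : Prop where
  left : IsPureIsometry S
  right : IsPureIsometry T
  comm : S * T = T * S
  annihilates : polyEval p S T = 0

/-- `(S,T)` on `H` and `(S',T')` on `H'` are unitarily equivalent. -/
def UnitarilyEquivalent {H' : Type*} [NormedAddCommGroup H'] [InnerProductSpace ℂ H']
    (S T : H →L[ℂ] H) (S' T' : H' →L[ℂ] H') : Prop :=
  ∃ U : H ≃ₗᵢ[ℂ] H', (∀ f, U (S f) = S' (U f)) ∧ (∀ f, U (T f) = T' (U f))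

variable [CompleteSpace H]

/-- The multiplicity `dim ker V*`. -/
noncomputable def mult (V : H →L[ℂ] H) : Cardinal :=
  Module.rank ℂ (LinearMap.ker (ContinuousLinearMap.adjoint V).toLinearMap)

/-- The bimultiplicity of a pair of isometries. -/
noncomputable def bimult (S T : H →L[ℂ] H) : Cardinal × Cardinal := (mult S, mult T)

/-- The joint eigenspace `ker (S - λ)* ∩ ker (T - μ)*` for `x = (λ, μ)`. -/
noncomputable def jointKer (S T : H →L[ℂ] H) (x : ℂ × ℂ) : Submodule ℂ H :=
  LinearMap.ker (ContinuousLinearMap.adjoint (S - x.1 • (1 : H →L[ℂ] H))).toLinearMap ⊓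
    LinearMap.ker (ContinuousLinearMap.adjoint (T - x.2 • (1 : H →L[ℂ] H))).toLinearMap

/-- For irreducible `p`: the pair `(S,T)` has rank `α`, where `α` is a positive integer, if
`dim (ker (S - λ)* ∩ ker (T - μ)*) = α` for all `(λ,μ) ∈ 𝔙(p)` that are regular points for `p`. -/
def HasRank (p : MvPolynomial (Fin 2) ℂ) (S T : H →L[ℂ] H) (α : ℕ) : Prop :=
  0 < α ∧ ∀ x ∈ variety p, IsRegularPoint p x → Module.rank ℂ (jointKer S T x) = α

end Operators

/-- The value at `x` of a matrix polynomial. -/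
noncomputable def matEval {a b : ℕ} (A : Matrix (Fin a) (Fin b) (MvPolynomial (Fin 2) ℂ))
    (x : ℂ × ℂ) : Matrix (Fin a) (Fin b) ℂ :=
  A.map (evalAt x)

/-- A rank `α` admissible triple `(K,P,Q)` over `𝔙(p)`, where `p` has bidegree `(n,m)`, that is,
degree `n` in `z` and degree `m` in `w`: matrix polynomials `Q` of size `α × mα` and `P` of size
`α × nα`, of full rank `α` at some point of `𝔙(p)`, and a kernel `K` with
`Q(z,w) Q(ζ,η)* / (1 - z ζ*) = K((z,w),(ζ,η)) = P(z,w) P(ζ,η)* / (1 - w η*)` on `𝔙(p)`. -/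
structure AdmissibleTriple (p : MvPolynomial (Fin 2) ℂ) (α : ℕ) where
  K : variety p → variety p → Matrix (Fin α) (Fin α) ℂ
  P : Matrix (Fin α) (Fin (p.degreeOf 0 * α)) (MvPolynomial (Fin 2) ℂ)
  Q : Matrix (Fin α) (Fin (p.degreeOf 1 * α)) (MvPolynomial (Fin 2) ℂ)
  eq_Q : ∀ x y : variety p,
    K x y = (1 - x.1.1 * conj y.1.1)⁻¹ • (matEval Q x.1 * (matEval Q y.1)ᴴ)
  eq_P : ∀ x y : variety p,
    K x y = (1 - x.1.2 * conj y.1.2)⁻¹ • (matEval P x.1 * (matEval P y.1)ᴴ)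
  fullRank : ∃ x ∈ variety p, (matEval Q x).rank = α ∧ (matEval P x).rank = α

namespace AdmissibleTriple

variable {p : MvPolynomial (Fin 2) ℂ} {α : ℕ}

/-- The kernel `K`, its values being regarded as operators on `ℂ^α`. -/
noncomputable def kernel (t : AdmissibleTriple p α) :
    Matrix (variety p) (variety p) (EuclideanSpace ℂ (Fin α) →L[ℂ] EuclideanSpace ℂ (Fin α)) :=
  Matrix.of fun x y => Matrix.toEuclideanCLM (𝕜 := ℂ) (t.K x y)

theorem inner_kernel (t : AdmissibleTriple p α) (x y : variety p)
    (u v : EuclideanSpace ℂ (Fin α)) :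
    inner ℂ (t.kernel x y u) v = (1 - y.1.1 * conj x.1.1)⁻¹ *
      inner ℂ (Matrix.toEuclideanLin (matEval t.Q y.1)ᴴ u)
        (Matrix.toEuclideanLin (matEval t.Q x.1)ᴴ v) := by
  have h : t.kernel x y u = (1 - x.1.1 * conj y.1.1)⁻¹ •
      Matrix.toEuclideanLin (matEval t.Q x.1)
        (Matrix.toEuclideanLin (matEval t.Q y.1)ᴴ u) := by
    ext i
    simp [kernel, t.eq_Q x y, Matrix.toLpLin_apply, Matrix.mulVec_mulVec]
  rw [h, inner_smul_left, Matrix.toEuclideanLin_conjTranspose_eq_adjoint (matEval t.Q x.1),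
    LinearMap.adjoint_inner_right]
  simp [mul_comm]

theorem posSemidef_kernel (t : AdmissibleTriple p α) : t.kernel.PosSemidef := by
  have h0 := (RKHS.posSemidef_tfae (K := t.kernel)).out 0 2
  refine h0.mpr ⟨?_, fun f => ?_⟩
  · refine Matrix.IsHermitian.ext fun x y => ?_
    refine ContinuousLinearMap.ext fun u => ext_inner_right ℂ fun v => ?_
    rw [ContinuousLinearMap.star_eq_adjoint, ContinuousLinearMap.adjoint_inner_left,
      ← inner_conj_symm, inner_kernel, inner_kernel, map_mul, inner_conj_symm]
    simp [mul_comm]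
  · set g : variety p → EuclideanSpace ℂ (Fin (p.degreeOf 1 * α)) :=
      fun x => Matrix.toEuclideanLin (matEval t.Q x.1)ᴴ (f x)
    have key : ∀ x y : variety p, HasSum (fun k : ℕ =>
        inner ℂ ((conj x.1.1) ^ k • g x) ((conj y.1.1) ^ k • g y))
        (inner ℂ (t.kernel y x (f x)) (f y)) := by
      intro x y
      rw [inner_kernel]
      have hlt : ‖x.1.1 * conj y.1.1‖ < 1 := by
        rw [norm_mul, RCLike.norm_conj]
        nlinarith [x.2.2.1, y.2.2.1, norm_nonneg x.1.1, norm_nonneg y.1.1]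
      refine ((hasSum_geometric_of_norm_lt_one hlt).mul_right (inner ℂ (g x) (g y))).congr_fun ?_
      intro k
      simp [mul_pow]
      ring
    have h2 : HasSum (fun k : ℕ => ∑ x ∈ f.support, ∑ y ∈ f.support,
        inner ℂ ((conj x.1.1) ^ k • g x) ((conj y.1.1) ^ k • g y))
        (∑ x ∈ f.support, ∑ y ∈ f.support, inner ℂ (t.kernel y x (f x)) (f y)) :=
      hasSum_sum fun x _ => hasSum_sum fun y _ => key x y
    have h3 := Complex.hasSum_re h2
    refine h3.nonneg fun k => ?_
    have h4 : (∑ x ∈ f.support, ∑ y ∈ f.support,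
        inner ℂ ((conj x.1.1) ^ k • g x) ((conj y.1.1) ^ k • g y)) =
        inner ℂ (∑ x ∈ f.support, (conj x.1.1) ^ k • g x)
          (∑ x ∈ f.support, (conj x.1.1) ^ k • g x) := by
      simp_rw [sum_inner, inner_sum]
    rw [h4]
    exact inner_self_nonneg (𝕜 := ℂ)

instance (t : AdmissibleTriple p α) : Fact t.kernel.PosSemidef := ⟨t.posSemidef_kernel⟩

/-- `H²(K)`: the Hilbert space of `ℂ^α`-valued functions on `𝔙(p)` with reproducing kernel `K`. -/
abbrev H2 (t : AdmissibleTriple p α) : Type := RKHS.OfKernel t.kernel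

/-- `M` is the operator on `H²(K)` of multiplication by the function `φ`. -/
def IsMultiplicationBy (t : AdmissibleTriple p α) (φ : ℂ × ℂ → ℂ) (M : t.H2 →L[ℂ] t.H2) : Prop :=
  ∀ (f : t.H2) (x : variety p), (M f) x = φ x.1 • f x

end AdmissibleTriple

/-! A pure isometry `S` behaves as the shift on analytic functions on the disk with values in `W =
ker S*`: `hS.ev z` is evaluation at `z`, and `T` becomes multiplication by an `End W`-valued
function `Φ = symbol T` with `p(z, Φ(z)) = 0`. For all but finitely many `z` in the disk, `p(z, ·)`
has `m` simple roots, which lie in the disk because `p` is inner toral. Hence `Φ(z)` is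
diagonalizable with these roots as its only possible eigenvalues. Each eigenspace has the dimension
`α` of the joint kernel at `(z, w)` (`finrank_jointKer`), so `dim W = mα`.

The function `Φ` is rational with no poles in the disk, because `ker T*` is finite-dimensional and
`S*`-invariant (`exists_denominator`). The difference quotient `(p(z, X) - p(z, w)) / (X - w)` at `X
= Φ(z)` is therefore a matrix polynomial `G(z, w)` up to a scalar denominator. It satisfies `G (Φ -
w) = 0` on the variety, and its range is generically the `w`-eigenspace. A constant matrix `C`
compresses it to `α` rows, and `Q` is `C G` times a polynomial (`exists_polynomial_frame`).

The maps `R_x f = Q(x) f(z)`, for `x = (z, w)`, satisfy `R_x S = z R_x` and `R_x T = w R_x`, and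
jointly they separate points. The Szegő kernel gives `R_x R_y* = Q(x) Q(y)* / (1 - z ζ̄)`. As `R_x`
kills the range of `T - w`, it factors through evaluation at `w` in the model where `T` is the
shift; this gives `P` and the second formula for the same kernel. Finally `f ↦ (R_x f)_x` is unitary
onto `H²(K)`. -/

/-! ### Fibers `p(z, ·)`: elimination and generic separability. -/

section Fiber

open Polynomial.Bivariate

/-- The polynomial `p(z, ·)`. -/
noncomputable def fiber (z : ℂ) : MvPolynomial (Fin 2) ℂ →ₐ[ℂ] Polynomial ℂ :=
  MvPolynomial.aeval ![Polynomial.C z, Polynomial.X]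

theorem eval_fiber (z w : ℂ) (p : MvPolynomial (Fin 2) ℂ) :
    (fiber z p).eval w = evalAt (z, w) p := by
  have : ((Polynomial.evalRingHom w).comp (fiber z).toRingHom) = evalAt (z, w) := by
    apply MvPolynomial.ringHom_ext
    · intro r; simp [fiber, evalAt]
    · intro i; fin_cases i <;> simp [fiber, evalAt]
  exact congrArg (fun f => f p) this

theorem fiber_equivMvPolynomial (z : ℂ) (B : Polynomial (Polynomial ℂ)) :
    fiber z (equivMvPolynomial ℂ B) = B.map (Polynomial.evalRingHom z) := by
  have : (((fiber z).toRingHom).comp (equivMvPolynomial ℂ : _ →+* _)) =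
      Polynomial.mapRingHom (Polynomial.evalRingHom z) := by
    apply Polynomial.ringHom_ext'
    · apply Polynomial.ringHom_ext' <;> [ext1 r; skip] <;> simp [fiber]
    · simp [fiber]
  exact congrArg (fun f => f B) this

theorem derivative_fiber (z : ℂ) (p : MvPolynomial (Fin 2) ℂ) :
    (fiber z p).derivative = fiber z (pderiv 1 p) := by
  obtain ⟨B, rfl⟩ := (equivMvPolynomial ℂ).surjective p
  rw [pderiv_one_equivMvPolynomial, fiber_equivMvPolynomial, fiber_equivMvPolynomial,
    Polynomial.derivative_map]

theorem fiber_eq_sum (z : ℂ) (p : MvPolynomial (Fin 2) ℂ) :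
    fiber z p = ∑ d ∈ p.support, (p.coeff d * z ^ d 0) • (Polynomial.X : Polynomial ℂ) ^ d 1 := by
  rw [fiber, MvPolynomial.aeval_def, MvPolynomial.eval₂_eq']
  refine Finset.sum_congr rfl fun d _ => ?_
  simp [Fin.prod_univ_two, Polynomial.smul_eq_C_mul, mul_assoc]

theorem coeff_equivMvPolynomial (B : Polynomial (Polynomial ℂ)) (d : Fin 2 →₀ ℕ) :
    (equivMvPolynomial ℂ B).coeff d = (B.coeff (d 1)).coeff (d 0) := by
  induction B using Polynomial.induction_on' with
  | add p q hp hq => simp [hp, hq]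
  | monomial n p =>
    induction p using Polynomial.induction_on' with
    | add p q hp hq => simp [hp, hq]
    | monomial k a =>
      have h : equivMvPolynomial ℂ (Polynomial.monomial n (Polynomial.monomial k a)) =
          MvPolynomial.monomial (Finsupp.single 0 k + Finsupp.single 1 n) a := by
        rw [← Polynomial.C_mul_X_pow_eq_monomial, ← Polynomial.C_mul_X_pow_eq_monomial]
        simp only [map_mul, map_pow, equivMvPolynomial_C_C, equivMvPolynomial_C_X,
          equivMvPolynomial_X]
        rw [MvPolynomial.monomial_eq]
        rw [Finsupp.prod_fintype _ _ (by simp)]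
        simp [Fin.prod_univ_two, mul_assoc]
      rw [h, MvPolynomial.coeff_monomial, Polynomial.coeff_monomial]
      have h2 : (Finsupp.single 0 k + Finsupp.single 1 n = d) ↔ (n = d 1 ∧ k = d 0) := by
        rw [Finsupp.ext_iff]
        simp [Fin.forall_fin_two, and_comm]
      simp only [h2]
      by_cases h3 : n = d 1
      · rw [if_pos h3, Polynomial.coeff_monomial]
        simp only [h3, true_and]
      · simp [h3]

theorem natDegree_eq_degreeOf (B : Polynomial (Polynomial ℂ)) :
    B.natDegree = (equivMvPolynomial ℂ B).degreeOf 1 := by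
  apply le_antisymm
  · rcases eq_or_ne B 0 with rfl | hB
    · simp
    have h1 : B.leadingCoeff ≠ 0 := by simpa using hB
    have h2 : Finsupp.single 0 B.leadingCoeff.natDegree + Finsupp.single 1 B.natDegree ∈
        (equivMvPolynomial ℂ B).support := by
      rw [MvPolynomial.mem_support_iff, coeff_equivMvPolynomial]
      simpa using hB
    simpa using MvPolynomial.monomial_le_degreeOf 1 h2
  · rw [MvPolynomial.degreeOf_le_iff]
    intro s hs
    rw [MvPolynomial.mem_support_iff, coeff_equivMvPolynomial] at hs
    apply Polynomial.le_natDegree_of_ne_zero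
    intro h
    simp [h] at hs

theorem isCoprime_of_irreducible_of_not_dvd {K : Type*} [Field K] {f g : Polynomial K}
    (hf : Irreducible f) (h : ¬ f ∣ g) : IsCoprime f g :=
  hf.coprime_iff_not_dvd.mpr h

/-- By Gauss's lemma `p` stays irreducible over `ℂ(z)`, so it is coprime to `q` there and the
resultant in `w` is nonzero. The resultant is a combination of `p` and `q`, hence vanishes at common
zeros. -/
theorem exists_eliminant {p q : MvPolynomial (Fin 2) ℂ} (hp : Irreducible p)
    (hm : p.degreeOf 1 ≠ 0) (hq : ¬ p ∣ q) :
    ∃ r : Polynomial ℂ, r ≠ 0 ∧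
      ∀ x : ℂ × ℂ, evalAt x p = 0 → evalAt x q = 0 → r.eval x.1 = 0 := by
  obtain ⟨B, rfl⟩ := (equivMvPolynomial ℂ).surjective p
  obtain ⟨C, rfl⟩ := (equivMvPolynomial ℂ).surjective q
  rw [← natDegree_eq_degreeOf] at hm
  rw [map_dvd_iff] at hq
  rw [MulEquiv.irreducible_iff] at hp
  have hprim : B.IsPrimitive := hp.isPrimitive hm
  let φ := algebraMap (Polynomial ℂ) (FractionRing (Polynomial ℂ))
  have hφ : Function.Injective φ := IsFractionRing.injective _ _
  have hirr : Irreducible (B.map φ) :=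
    (hprim.irreducible_iff_irreducible_map_fraction_map).mp hp
  have hcop : IsCoprime (B.map φ) (C.map φ) :=
    isCoprime_of_irreducible_of_not_dvd hirr
      fun h => hq (hprim.dvd_of_fraction_map_dvd_fraction_map h)
  refine ⟨B.resultant C, ?_, ?_⟩
  · intro h
    have h1 : (B.map φ).resultant (C.map φ) B.natDegree C.natDegree = 0 := by
      rw [Polynomial.resultant_map_map, h, map_zero]
    rw [← Polynomial.natDegree_map_eq_of_injective hφ B,
      ← Polynomial.natDegree_map_eq_of_injective hφ C, Polynomial.resultant_eq_zero_iff] at h1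
    exact h1.2 hcop
  · rintro ⟨z, w⟩ h1 h2
    obtain ⟨a, b, -, -, hab⟩ := Polynomial.exists_mul_add_mul_eq_C_resultant B C le_rfl le_rfl
      (Or.inl hm)
    rw [← eval_fiber, fiber_equivMvPolynomial] at h1 h2
    have := congrArg (fun f => (f.map (Polynomial.evalRingHom z)).eval w) hab
    simpa [h1, h2] using this.symm

/-- The exceptional `z` are the zeros of the leading coefficient in `w`, where the degree drops, and
those of an eliminant of `p` and `∂p/∂w`, which catches repeated roots. -/
theorem exists_separable_fiber {p : MvPolynomial (Fin 2) ℂ} (hp : Irreducible p)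
    (hm : p.degreeOf 1 ≠ 0) :
    ∃ r : Polynomial ℂ, r ≠ 0 ∧ ∀ z, r.eval z ≠ 0 →
      (fiber z p).natDegree = p.degreeOf 1 ∧ (fiber z p).Separable := by
  have hnd : ¬ p ∣ pderiv 1 p := by
    obtain ⟨B, rfl⟩ := (equivMvPolynomial ℂ).surjective p
    rw [← natDegree_eq_degreeOf] at hm
    rw [pderiv_one_equivMvPolynomial, map_dvd_iff]
    intro h
    by_cases h0 : B.derivative = 0
    · exact hm (Polynomial.derivative_eq_zero.mp h0)
    · exact absurd (Polynomial.natDegree_le_of_dvd h h0)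
        (not_le.mpr (Polynomial.natDegree_derivative_lt hm))
  obtain ⟨r, hr, hr'⟩ := exists_eliminant hp hm hnd
  obtain ⟨B, rfl⟩ := (equivMvPolynomial ℂ).surjective p
  rw [← natDegree_eq_degreeOf] at hm ⊢
  have hB : B.leadingCoeff ≠ 0 := by
    intro h
    simp [Polynomial.leadingCoeff_eq_zero.mp h] at hm
  refine ⟨r * B.leadingCoeff, mul_ne_zero hr hB, fun z hz => ?_⟩
  rw [Polynomial.eval_mul] at hz
  have hd : (fiber z (equivMvPolynomial ℂ B)).natDegree = B.natDegree := by
    rw [fiber_equivMvPolynomial]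
    exact Polynomial.natDegree_map_of_leadingCoeff_ne_zero _ (right_ne_zero_of_mul hz)
  refine ⟨hd, ?_⟩
  rw [Polynomial.Separable, Polynomial.isCoprime_iff_aeval_ne_zero_of_isAlgClosed ℂ ℂ]
  intro w
  by_contra! h
  simp only [Polynomial.coe_aeval_eq_eval, derivative_fiber, eval_fiber] at h
  exact left_ne_zero_of_mul hz (hr' (z, w) h.1 h.2)

/-- Otherwise the zero set contains a whole line `{z} × ℂ`, and `w = 0` and `w = 2` force
incompatible conditions on `‖z‖`. -/
theorem IsInnerToral.degreeOf_one_ne_zero {p : MvPolynomial (Fin 2) ℂ} (hpt : IsInnerToral p)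
    (hp : Irreducible p) : p.degreeOf 1 ≠ 0 := by
  intro hm
  obtain ⟨B, rfl⟩ := (equivMvPolynomial ℂ).surjective p
  rw [← natDegree_eq_degreeOf] at hm
  obtain ⟨c, rfl⟩ : ∃ c, B = Polynomial.C c := ⟨_, Polynomial.eq_C_of_natDegree_eq_zero hm⟩
  rw [MulEquiv.irreducible_iff] at hp
  have hc : c.degree ≠ 0 := by
    intro h
    exact hp.not_isUnit ((Polynomial.isUnit_iff_degree_eq_zero.mpr h).map Polynomial.C)
  obtain ⟨z, hz⟩ := IsAlgClosed.exists_root c hc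
  have h0 : ∀ w, evalAt (z, w) (equivMvPolynomial ℂ (Polynomial.C c)) = 0 := by
    intro w
    rw [← eval_fiber, fiber_equivMvPolynomial]
    simpa using hz
  have h1 := hpt _ (h0 0)
  have h2 := hpt _ (h0 2)
  simp at h1 h2
  rcases h1 with h1 | h1 <;> linarith

theorem IsInnerToral.mem_variety {p : MvPolynomial (Fin 2) ℂ} (hpt : IsInnerToral p) {z w : ℂ}
    (hz : ‖z‖ < 1) (h : (fiber z p).IsRoot w) : (z, w) ∈ variety p := by
  have h0 : evalAt (z, w) p = 0 := by rw [← eval_fiber]; exact h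
  have h1 := hpt _ h0
  refine ⟨h0, hz, ?_⟩
  rcases h1 with h1 | h1 | h1
  · exact h1.2
  · exact absurd h1.1 hz.ne
  · exact absurd h1.1 hz.not_gt

theorem isRegularPoint_of_separable {p : MvPolynomial (Fin 2) ℂ} {z w : ℂ}
    (hs : (fiber z p).Separable) (h : (fiber z p).IsRoot w) : IsRegularPoint p (z, w) := by
  refine ⟨by rw [← eval_fiber]; exact h, Or.inr ?_⟩
  rw [← eval_fiber, ← derivative_fiber]
  exact hs.eval₂_derivative_ne_zero (RingHom.id ℂ) h

theorem aeval_fiber {A : Type*} [Ring A] [Algebra ℂ A] (z : ℂ) (p : MvPolynomial (Fin 2) ℂ)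
    (a : A) : Polynomial.aeval a (fiber z p) =
      ∑ d ∈ p.support, (p.coeff d * z ^ d 0) • a ^ d 1 := by
  simp [fiber_eq_sum]

end Fiber

/-! ### Symmetry in the variables, used to compute `dim ker T*`. -/

section Swap

/-- Interchange of the two variables. -/
noncomputable def swapVars : MvPolynomial (Fin 2) ℂ ≃ₐ[ℂ] MvPolynomial (Fin 2) ℂ :=
  renameEquiv ℂ (Equiv.swap (0 : Fin 2) 1)

theorem evalAt_swapVars (x : ℂ × ℂ) (p : MvPolynomial (Fin 2) ℂ) :
    evalAt x (swapVars p) = evalAt x.swap p := by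
  simp only [evalAt, swapVars, renameEquiv_apply, eval_rename]
  congr 2
  ext i
  fin_cases i <;> simp

theorem IsInnerToral.swapVars {p : MvPolynomial (Fin 2) ℂ} (h : IsInnerToral p) :
    IsInnerToral (swapVars p) := by
  intro x hx
  rw [evalAt_swapVars] at hx
  have := h _ hx
  simp only [Prod.fst_swap, Prod.snd_swap] at this
  tauto

theorem degreeOf_swapVars (p : MvPolynomial (Fin 2) ℂ) :
    (swapVars p).degreeOf 1 = p.degreeOf 0 := by
  have := degreeOf_rename_of_injective (p := p) (Equiv.swap (0 : Fin 2) 1).injective 0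
  simpa [swapVars] using this

theorem IsRegularPoint.of_swapVars {p : MvPolynomial (Fin 2) ℂ} {x : ℂ × ℂ}
    (h : IsRegularPoint (_root_.swapVars p) x) : IsRegularPoint p x.swap := by
  refine ⟨by rw [← evalAt_swapVars]; exact h.1, ?_⟩
  have h0 : pderiv 0 (_root_.swapVars p) = _root_.swapVars (pderiv 1 p) := by
    have := pderiv_rename (Equiv.swap (0 : Fin 2) 1).injective 1 p
    simpa [_root_.swapVars] using this
  have h1 : pderiv 1 (_root_.swapVars p) = _root_.swapVars (pderiv 0 p) := by
    have := pderiv_rename (Equiv.swap (0 : Fin 2) 1).injective 0 p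
    simpa [_root_.swapVars] using this
  have := h.2
  rw [h0, h1, evalAt_swapVars, evalAt_swapVars] at this
  exact this.symm

variable {H : Type*} [NormedAddCommGroup H] [InnerProductSpace ℂ H]

theorem polyEval_swapVars (p : MvPolynomial (Fin 2) ℂ) {S T : H →L[ℂ] H} (h : S * T = T * S) :
    polyEval (swapVars p) T S = polyEval p S T := by
  have hs : (swapVars p).support = p.support.image (Finsupp.mapDomain (Equiv.swap (0 : Fin 2) 1)) :=
    support_rename_of_injective (Equiv.swap (0 : Fin 2) 1).injective
  rw [polyEval, polyEval, hs,
    Finset.sum_image (Finsupp.mapDomain_injective (Equiv.swap (0 : Fin 2) 1).injective).injOn]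
  refine Finset.sum_congr rfl fun d _ => ?_
  have h0 : Finsupp.mapDomain (Equiv.swap (0 : Fin 2) 1) d 0 = d 1 := by
    exact Finsupp.mapDomain_apply (Equiv.swap (0 : Fin 2) 1).injective d 1
  have h1 : Finsupp.mapDomain (Equiv.swap (0 : Fin 2) 1) d 1 = d 0 := by
    exact Finsupp.mapDomain_apply (Equiv.swap (0 : Fin 2) 1).injective d 0
  have h2 : (swapVars p).coeff (Finsupp.mapDomain (Equiv.swap (0 : Fin 2) 1) d) = p.coeff d :=
    coeff_rename_mapDomain _ (Equiv.swap (0 : Fin 2) 1).injective _ _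
  rw [h0, h1, h2, ((show Commute S T from h).pow_pow _ _).eq]

theorem IsPureIsopair.swapVars {p : MvPolynomial (Fin 2) ℂ} {S T : H →L[ℂ] H}
    (h : IsPureIsopair p S T) : IsPureIsopair (_root_.swapVars p) T S where
  left := h.right
  right := h.left
  comm := h.comm.symm
  annihilates := by rw [polyEval_swapVars p h.comm, h.annihilates]

theorem HasRank.swapVars [CompleteSpace H] {p : MvPolynomial (Fin 2) ℂ} {S T : H →L[ℂ] H} {α : ℕ}
    (h : HasRank p S T α) : HasRank (_root_.swapVars p) T S α := by
  refine ⟨h.1, fun x hx hr => ?_⟩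
  have := h.2 x.swap ⟨by rw [← evalAt_swapVars]; exact hx.1, hx.2.2, hx.2.1⟩ hr.of_swapVars
  rwa [jointKer, inf_comm] at this

end Swap

/-! ### The shift model of a pure isometry and the symbol of `T`. -/

section Evaluation

open ContinuousLinearMap Filter Topology
open scoped InnerProduct

variable {H : Type*} [NormedAddCommGroup H] [InnerProductSpace ℂ H]

theorem ContinuousLinearMap.mul_apply_comp (A B : H →L[ℂ] H) (f : H) : (A * B) f = A (B f) := rfl

variable [CompleteSpace H]

/-- The wandering subspace `ker S*` of an isometry `S`. -/
noncomputable abbrev wandering (S : H →L[ℂ] H) : Submodule ℂ H := LinearMap.ker (S†).toLinearMap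

theorem mem_wandering {S : H →L[ℂ] H} {f : H} : f ∈ wandering S ↔ (S†) f = 0 := Iff.rfl

namespace IsPureIsometry

variable {S T : H →L[ℂ] H}

theorem adjoint_apply_apply (hS : IsPureIsometry S) (f : H) : (S†) (S f) = f :=
  congrArg (fun A : H →L[ℂ] H => A f) ((norm_map_iff_adjoint_comp_self S).mp hS.isometry)

theorem norm_adjoint_apply_le (hS : IsPureIsometry S) (f : H) : ‖(S†) f‖ ≤ ‖f‖ := by
  have h1 : ‖S‖ ≤ 1 := opNorm_le_bound _ zero_le_one fun x => by rw [hS.isometry, one_mul]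
  calc ‖(S†) f‖ ≤ ‖S†‖ * ‖f‖ := le_opNorm _ _
    _ = ‖S‖ * ‖f‖ := by rw [LinearIsometryEquiv.norm_map]
    _ ≤ 1 * ‖f‖ := by gcongr
    _ = ‖f‖ := one_mul _

/-- The projection `1 - S S*` onto `ker S*`. -/
noncomputable def proj (hS : IsPureIsometry S) : H →L[ℂ] wandering S :=
  (1 - S ∘L S†).codRestrict (wandering S) fun f => by
    simp [hS.adjoint_apply_apply]

theorem coe_proj (hS : IsPureIsometry S) (f : H) : (hS.proj f : H) = f - S ((S†) f) := rfl

theorem proj_coe (hS : IsPureIsometry S) (c : wandering S) : hS.proj c = c := by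
  ext
  have : (S†) (c : H) = 0 := c.2
  simp [coe_proj, this]

theorem proj_apply (hS : IsPureIsometry S) (f : H) : hS.proj (S f) = 0 := by
  ext
  simp [coe_proj, hS.adjoint_apply_apply]

theorem inner_proj (hS : IsPureIsometry S) (f : H) (c : wandering S) :
    inner ℂ (hS.proj f) c = inner ℂ f (c : H) := by
  rw [Submodule.coe_inner, coe_proj, inner_sub_left, ← adjoint_inner_right]
  have : (S†) (c : H) = 0 := c.2
  simp [this]

theorem isUnit_one_sub (hS : IsPureIsometry S) {z : ℂ} (hz : ‖z‖ < 1) :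
    IsUnit (1 - z • S†) := by
  apply isUnit_one_sub_of_norm_lt_one
  refine lt_of_le_of_lt ?_ hz
  refine opNorm_le_bound _ (norm_nonneg _) fun f => ?_
  rw [FunLike.coe_smul, Pi.smul_apply, norm_smul]
  gcongr
  exact hS.norm_adjoint_apply_le f

/-- The value at `z` of `f`, regarded as a `ker S*`-valued analytic function on the disk:
`∑ⱼ zʲ (1 - S S*) S*ʲ f`. -/
noncomputable def ev (hS : IsPureIsometry S) (z : ℂ) : H →L[ℂ] wandering S :=
  hS.proj ∘L Ring.inverse (1 - z • S†)

theorem ev_sub (hS : IsPureIsometry S) {z : ℂ} (hz : ‖z‖ < 1) (f : H) :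
    hS.ev z (f - z • (S†) f) = hS.proj f := by
  have := congrArg (fun A : H →L[ℂ] H => hS.proj (A f))
    (Ring.inverse_mul_cancel _ (hS.isUnit_one_sub hz))
  simpa [ev] using this

theorem exists_ev (hS : IsPureIsometry S) {z : ℂ} (hz : ‖z‖ < 1) (f : H) :
    ∃ g, g - z • (S†) g = f ∧ hS.ev z f = hS.proj g := by
  refine ⟨Ring.inverse (1 - z • S†) f, ?_, rfl⟩
  have := congrArg (fun A : H →L[ℂ] H => A f)
    (Ring.mul_inverse_cancel _ (hS.isUnit_one_sub hz))
  simpa using this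

theorem ev_apply (hS : IsPureIsometry S) {z : ℂ} (hz : ‖z‖ < 1) (f : H) :
    hS.ev z (S f) = z • hS.ev z f := by
  obtain ⟨g, rfl, hg⟩ := hS.exists_ev hz f
  rw [hg]
  have h : S (g - z • (S†) g) = (S g - z • (S†) (S g)) + z • (g - S ((S†) g)) := by
    rw [hS.adjoint_apply_apply, map_sub, map_smul, smul_sub]
    abel
  have h2 : hS.ev z (g - S ((S†) g)) = hS.proj g := by
    have h3 := hS.ev_sub hz (g - S ((S†) g))
    rw [map_sub (S†), hS.adjoint_apply_apply, sub_self, smul_zero, sub_zero] at h3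
    rw [h3, map_sub, hS.proj_apply, sub_zero]
  rw [h, map_add, hS.ev_sub hz, hS.proj_apply, zero_add, map_smul, h2]

theorem ev_coe (hS : IsPureIsometry S) {z : ℂ} (hz : ‖z‖ < 1) (c : wandering S) :
    hS.ev z c = c := by
  have := hS.ev_sub hz c
  have h : (S†) (c : H) = 0 := c.2
  rwa [h, smul_zero, sub_zero, proj_coe] at this

/-- With `f = g - z S*g`, vanishing at `z` says `g = S S*g`, so `f = (S - z) S*g`. -/
theorem exists_of_ev_eq_zero (hS : IsPureIsometry S) {z : ℂ} (hz : ‖z‖ < 1) {f : H}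
    (hf : hS.ev z f = 0) : ∃ g, f = S g - z • g := by
  obtain ⟨g, rfl, hg⟩ := hS.exists_ev hz f
  rw [hg] at hf
  have h : g = S ((S†) g) := by
    have := congrArg Subtype.val hf
    rwa [coe_proj, ZeroMemClass.coe_zero, sub_eq_zero] at this
  exact ⟨(S†) g, by rw [← h]⟩

/-- `f - f(z)` lies in the range of `S - z`, which `T` preserves and evaluation at `z` kills. -/
theorem ev_comm (hS : IsPureIsometry S) (hST : S * T = T * S) {z : ℂ} (hz : ‖z‖ < 1) (f : H) :
    hS.ev z (T f) = hS.ev z (T (hS.ev z f)) := by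
  have h0 : hS.ev z (f - hS.ev z f) = 0 := by rw [map_sub, hS.ev_coe hz, sub_self]
  obtain ⟨g, hg⟩ := hS.exists_of_ev_eq_zero hz h0
  rw [← sub_eq_zero, ← map_sub, ← map_sub, hg, map_sub, map_smul]
  have : T (S g) = S (T g) := (congrArg (fun A : H →L[ℂ] H => A g) hST).symm
  rw [this, map_sub, map_smul, hS.ev_apply hz, sub_self]

theorem adjoint_adjoint_ev (hS : IsPureIsometry S) [FiniteDimensional ℂ (wandering S)]
    {z : ℂ} (hz : ‖z‖ < 1) (c : wandering S) :
    (S†) (((hS.ev z)†) c) = conj z • ((hS.ev z)†) c := by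
  refine ext_inner_right ℂ fun f => ?_
  rw [adjoint_inner_left, adjoint_inner_left, hS.ev_apply hz, inner_smul_left, inner_smul_right,
    adjoint_inner_left, RCLike.conj_conj]

theorem proj_adjoint_ev (hS : IsPureIsometry S) [FiniteDimensional ℂ (wandering S)]
    {z : ℂ} (hz : ‖z‖ < 1) (c : wandering S) : hS.proj (((hS.ev z)†) c) = c := by
  refine ext_inner_right ℂ fun d => ?_
  rw [inner_proj, adjoint_inner_left, hS.ev_coe hz]

/-- Szegő kernel: `k = c + S S*k` and `S*k = ζ̄ k` give `k(z) = c + z ζ̄ k(z)`. -/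
theorem ev_adjoint_ev (hS : IsPureIsometry S) [FiniteDimensional ℂ (wandering S)]
    {z ζ : ℂ} (hz : ‖z‖ < 1) (hζ : ‖ζ‖ < 1) (c : wandering S) :
    hS.ev z (((hS.ev ζ)†) c) = (1 - z * conj ζ)⁻¹ • c := by
  set k := ((hS.ev ζ)†) c
  have h1 : k = c + S ((S†) k) := by
    have := congrArg Subtype.val (hS.proj_adjoint_ev hζ c)
    rw [coe_proj, sub_eq_iff_eq_add] at this
    exact this
  rw [hS.adjoint_adjoint_ev hζ] at h1
  have h2 : hS.ev z k = c + (z * conj ζ) • hS.ev z k := by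
    conv_lhs => rw [h1]
    rw [map_add, hS.ev_coe hz, map_smul, map_smul, hS.ev_apply hz, smul_smul, mul_comm z]
  have h3 : 1 - z * conj ζ ≠ 0 := by
    intro h
    have h4 : ‖z * conj ζ‖ = 1 := by rw [← sub_eq_zero.mp h, norm_one]
    rw [norm_mul, RCLike.norm_conj] at h4
    nlinarith [norm_nonneg z, norm_nonneg ζ]
  rw [eq_inv_smul_iff₀ h3, sub_smul, one_smul, sub_eq_iff_eq_add]
  exact h2

/-- Two eigenvectors of `S*` for `z̄` with the same projection differ by some `h` with `h = z̄ S h`;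
comparing norms gives `h = 0`. -/
theorem adjoint_ev_proj (hS : IsPureIsometry S) [FiniteDimensional ℂ (wandering S)]
    {z : ℂ} (hz : ‖z‖ < 1) {f : H} (hf : (S†) f = conj z • f) :
    ((hS.ev z)†) (hS.proj f) = f := by
  set k := ((hS.ev z)†) (hS.proj f)
  have h1 : k - S ((S†) k) = f - S ((S†) f) :=
    congrArg Subtype.val (hS.proj_adjoint_ev hz (hS.proj f))
  rw [hS.adjoint_adjoint_ev hz, hf] at h1
  have h2 : k - f = conj z • S (k - f) := by
    rw [map_smul S, map_smul S] at h1
    rw [map_sub, smul_sub]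
    rw [sub_eq_sub_iff_sub_eq_sub]
    exact h1
  have h3 : ‖k - f‖ = ‖z‖ * ‖k - f‖ := by
    conv_lhs => rw [h2, norm_smul, hS.isometry, RCLike.norm_conj]
  have h4 : ‖k - f‖ = 0 := by nlinarith [norm_nonneg (k - f)]
  exact sub_eq_zero.mp (norm_eq_zero.mp h4)

theorem continuousAt_ev (hS : IsPureIsometry S) (f : H) :
    ContinuousAt (fun z => hS.ev z f) 0 := by
  have h1 : ContinuousAt (fun z : ℂ => Ring.inverse (1 - z • S†)) 0 := by
    have h2 : ContinuousAt (fun z : ℂ => 1 - z • S†) 0 := by fun_prop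
    refine ContinuousAt.comp (g := Ring.inverse) ?_ h2
    obtain ⟨u, hu⟩ := hS.isUnit_one_sub (z := 0) (by simp)
    rw [← hu]
    exact NormedRing.inverse_continuousAt u
  have h3 : ContinuousAt (fun z : ℂ => Ring.inverse (1 - z • S†) f) 0 :=
    h1.clm_apply continuousAt_const
  exact hS.proj.continuous.continuousAt.comp h3

/-- By continuity `f` vanishes at `0` too, so `f = S k`, and `k` again vanishes near `0`. Iterating
puts `f` in every `Sʲ H`, and purity applies. -/
theorem eq_zero_of_eventually_ev (hS : IsPureIsometry S) {f : H}
    (hf : ∀ᶠ z in 𝓝[≠] (0 : ℂ), hS.ev z f = 0) : f = 0 := by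
  apply hS.pure
  intro j
  suffices h : ∃ g, (S ^ j) g = f ∧ ∀ᶠ z in 𝓝[≠] (0 : ℂ), hS.ev z g = 0 by
    obtain ⟨g, hg, -⟩ := h
    exact ⟨g, hg⟩
  have hball : ∀ᶠ z in 𝓝[≠] (0 : ℂ), ‖z‖ < 1 ∧ z ≠ 0 := by
    refine ((eventually_nhdsWithin_of_eventually_nhds ?_).and eventually_mem_nhdsWithin)
    filter_upwards [Metric.ball_mem_nhds (0 : ℂ) one_pos] with z hz
    simpa using hz
  induction j with
  | zero => exact ⟨f, rfl, hf⟩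
  | succ j ih =>
    obtain ⟨g, hg, hg0⟩ := ih
    have h0 : hS.ev 0 g = 0 := by
      have h1 : Tendsto (fun z => hS.ev z g) (𝓝[≠] 0) (𝓝 (hS.ev 0 g)) :=
        (hS.continuousAt_ev g).tendsto.mono_left nhdsWithin_le_nhds
      have h2 : Tendsto (fun z => hS.ev z g) (𝓝[≠] 0) (𝓝 0) :=
        tendsto_const_nhds.congr' (hg0.mono fun z hz => hz.symm)
      exact tendsto_nhds_unique h1 h2
    obtain ⟨k, hk⟩ := hS.exists_of_ev_eq_zero (by simp) h0
    rw [zero_smul, sub_zero] at hk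
    refine ⟨k, ?_, ?_⟩
    · rw [pow_succ, mul_apply_comp, ← hk, hg]
    · filter_upwards [hg0, hball] with z hz hz'
      rw [hk, hS.ev_apply hz'.1] at hz
      exact (smul_eq_zero.mp hz).resolve_left hz'.2

/-- The function `Φ` with `T = M_Φ`, when `S` is regarded as the shift. -/
noncomputable def symbol (hS : IsPureIsometry S) (T : H →L[ℂ] H) (z : ℂ) :
    wandering S →ₗ[ℂ] wandering S :=
  (hS.ev z).toLinearMap ∘ₗ T.toLinearMap ∘ₗ (wandering S).subtype

theorem symbol_apply (hS : IsPureIsometry S) (z : ℂ) (c : wandering S) :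
    hS.symbol T z c = hS.ev z (T c) := rfl

theorem ev_comm_symbol (hS : IsPureIsometry S) (hST : S * T = T * S) {z : ℂ} (hz : ‖z‖ < 1)
    (f : H) : hS.ev z (T f) = hS.symbol T z (hS.ev z f) :=
  hS.ev_comm hST hz f

theorem ev_pow (hS : IsPureIsometry S) {z : ℂ} (hz : ‖z‖ < 1) (a : ℕ) (f : H) :
    hS.ev z ((S ^ a) f) = z ^ a • hS.ev z f := by
  induction a with
  | zero => simp
  | succ a ih =>
    rw [pow_succ', mul_apply_comp, hS.ev_apply hz, ih, smul_smul, pow_succ']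

theorem ev_comm_symbol_pow (hS : IsPureIsometry S) (hST : S * T = T * S) {z : ℂ} (hz : ‖z‖ < 1)
    (a : ℕ) (f : H) : hS.ev z ((T ^ a) f) = (hS.symbol T z ^ a) (hS.ev z f) := by
  induction a with
  | zero => simp
  | succ a ih =>
    rw [pow_succ', mul_apply_comp, hS.ev_comm_symbol hST hz, ih, pow_succ', Module.End.mul_apply]

end IsPureIsometry

theorem IsPureIsopair.aeval_symbol {p : MvPolynomial (Fin 2) ℂ} {S T : H →L[ℂ] H}
    (hV : IsPureIsopair p S T) {z : ℂ} (hz : ‖z‖ < 1) :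
    Polynomial.aeval (hV.left.symbol T z) (fiber z p) = 0 := by
  ext1 c
  have h := congrArg (fun A : H →L[ℂ] H => hV.left.ev z (A c)) hV.annihilates
  simp only [polyEval, sum_apply, map_sum, FunLike.coe_smul, Pi.smul_apply, mul_apply_comp, map_smul,
    hV.left.ev_pow hz, hV.left.ev_comm_symbol_pow hV.comm hz, hV.left.ev_coe hz, zero_apply,
    map_zero] at h
  rw [aeval_fiber, LinearMap.sum_apply, LinearMap.zero_apply, ← h]
  simp [smul_smul]

theorem LinearMap.finrank_ker_adjoint_eq {W : Type*} [NormedAddCommGroup W]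
    [InnerProductSpace ℂ W] [FiniteDimensional ℂ W] (A : W →ₗ[ℂ] W) :
    Module.finrank ℂ (LinearMap.ker (LinearMap.adjoint A)) =
      Module.finrank ℂ (LinearMap.ker A) := by
  have h1 : LinearMap.ker (LinearMap.adjoint A) = (LinearMap.range A)ᗮ := by
    ext x
    rw [LinearMap.mem_ker, Submodule.mem_orthogonal]
    constructor
    · rintro h _ ⟨y, rfl⟩
      rw [← LinearMap.adjoint_inner_right, h, inner_zero_right]
    · intro h
      refine ext_inner_left ℂ fun y => ?_
      rw [LinearMap.adjoint_inner_right, h _ ⟨y, rfl⟩, inner_zero_right]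
  have h2 := LinearMap.finrank_range_add_finrank_ker A
  have h3 := Submodule.finrank_add_finrank_orthogonal (LinearMap.range A)
  rw [h1]
  omega

/-- The adjoint of evaluation at `z` is injective and maps `ker (Φ(z) - w)*` onto the joint kernel;
on the finite-dimensional `W`, an operator and its adjoint have kernels of equal dimension. -/
theorem IsPureIsometry.finrank_jointKer {S T : H →L[ℂ] H} (hS : IsPureIsometry S)
    (hST : S * T = T * S) [FiniteDimensional ℂ (wandering S)] {x : ℂ × ℂ} (hx : ‖x.1‖ < 1) :
    Module.finrank ℂ (jointKer S T x) =
      Module.finrank ℂ (Module.End.eigenspace (hS.symbol T x.1) x.2) := by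
  set A : wandering S →ₗ[ℂ] wandering S :=
    hS.symbol T x.1 - x.2 • LinearMap.id with hA
  have hmem : ∀ f, f ∈ jointKer S T x ↔ (S†) f = conj x.1 • f ∧ (T†) f = conj x.2 • f := by
    intro f
    simp [jointKer, sub_eq_zero, ← star_eq_adjoint]
  have hT : ∀ c, (T†) (((hS.ev x.1)†) c) - conj x.2 • ((hS.ev x.1)†) c =
      ((hS.ev x.1)†) (LinearMap.adjoint A c) := by
    intro c
    refine ext_inner_right ℂ fun f => ?_
    rw [inner_sub_left, adjoint_inner_left, adjoint_inner_left, adjoint_inner_left,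
      inner_smul_left, adjoint_inner_left, LinearMap.adjoint_inner_left, hS.ev_comm_symbol hST hx]
    simp [hA, inner_sub_right, inner_smul_right]
  have hinj : Function.Injective ((hS.ev x.1)†) := by
    intro c d h
    rw [← hS.proj_adjoint_ev hx c, h, hS.proj_adjoint_ev hx]
  have hmap : jointKer S T x =
      (LinearMap.ker (LinearMap.adjoint A)).map ((hS.ev x.1)†).toLinearMap := by
    ext f
    rw [hmem, Submodule.mem_map]
    constructor
    · rintro ⟨h1, h2⟩
      have h3 := hS.adjoint_ev_proj hx h1
      refine ⟨hS.proj f, ?_, h3⟩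
      have h4 := hT (hS.proj f)
      rw [h3, h2, sub_self] at h4
      exact hinj (by rw [← h4, map_zero])
    · rintro ⟨c, hc, rfl⟩
      refine ⟨hS.adjoint_adjoint_ev hx c, ?_⟩
      have h4 := hT c
      rw [LinearMap.mem_ker.mp hc, map_zero, sub_eq_zero] at h4
      exact h4
  rw [hmap, (Submodule.equivMapOfInjective _ hinj _).finrank_eq.symm, LinearMap.finrank_ker_adjoint_eq]
  have hker : LinearMap.ker A = Module.End.eigenspace (hS.symbol T x.1) x.2 := by
    ext c
    simp [hA, sub_eq_zero]
  rw [hker]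

end Evaluation

/-! ### Eigenspaces of an operator annihilated by a separable polynomial. -/

section Resolvent

open Module
open scoped Polynomial

variable {W : Type*} [AddCommGroup W] [Module ℂ W]

theorem aeval_apply_of_mem_eigenspace {A : End ℂ W} {μ : ℂ} {v : W}
    (hv : v ∈ End.eigenspace A μ) (h : ℂ[X]) : Polynomial.aeval A h v = h.eval μ • v := by
  rcases eq_or_ne v 0 with rfl | hv0
  · simp
  · exact End.aeval_apply_of_hasEigenvector ⟨hv, hv0⟩

theorem eigenspace_eq_bot_of_not_isRoot {A : End ℂ W} {q : ℂ[X]} (hA : Polynomial.aeval A q = 0) {μ : ℂ}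
    (hμ : ¬ q.IsRoot μ) : End.eigenspace A μ = ⊥ := by
  rw [Submodule.eq_bot_iff]
  intro v hv
  have := aeval_apply_of_mem_eigenspace hv q
  rw [hA, LinearMap.zero_apply] at this
  exact (smul_eq_zero.mp this.symm).resolve_left hμ

theorem eval_ne_zero_of_mul_eq {q h : ℂ[X]} (hq : q.Separable) {w : ℂ}
    (hh : h * (Polynomial.X - Polynomial.C w) = q) : h.eval w ≠ 0 := by
  have hw : q.IsRoot w := by rw [← hh]; simp
  have h1 := hq.eval₂_derivative_ne_zero (RingHom.id ℂ) hw
  rw [← hh] at h1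
  simpa using h1

/-- `(A - w) h(A) = q(A) = 0` gives one inclusion. For the other, `h(A)` acts on the eigenspace as
the scalar `h(w)`, nonzero since `w` is a simple root. -/
theorem range_aeval_eq_eigenspace {A : End ℂ W} {q h : ℂ[X]} (hq : q.Separable)
    (hA : Polynomial.aeval A q = 0) {w : ℂ} (hh : h * (Polynomial.X - Polynomial.C w) = q) :
    LinearMap.range (Polynomial.aeval A h) = End.eigenspace A w := by
  apply le_antisymm
  · rintro _ ⟨u, rfl⟩
    have h1 : Polynomial.aeval A ((Polynomial.X - Polynomial.C w) * h) u = 0 := by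
      rw [mul_comm, hh, hA, LinearMap.zero_apply]
    rw [map_mul, End.mul_apply] at h1
    rw [End.mem_eigenspace_iff]
    simpa [sub_eq_zero] using h1
  · intro v hv
    refine ⟨(h.eval w)⁻¹ • v, ?_⟩
    rw [map_smul, aeval_apply_of_mem_eigenspace hv,
      inv_smul_smul₀ (eval_ne_zero_of_mul_eq hq hh)]

variable [FiniteDimensional ℂ W]

theorem iSup_eigenspace_eq_top_of_separable {A : End ℂ W} {q : ℂ[X]} (hq : q.Separable)
    (hA : Polynomial.aeval A q = 0) : ⨆ μ, End.eigenspace A μ = ⊤ :=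
  (End.isSemisimple_of_squarefree_aeval_eq_zero hq.squarefree hA).iSup_eigenspace_eq_top

theorem finrank_eq_natDegree_mul {A : End ℂ W} {q : ℂ[X]} (hq : q.Separable)
    (hA : Polynomial.aeval A q = 0) {α : ℕ}
    (hα : ∀ μ, q.IsRoot μ → finrank ℂ (End.eigenspace A μ) = α) :
    finrank ℂ W = q.natDegree * α := by
  have hq0 : q ≠ 0 := hq.ne_zero
  let F : q.roots.toFinset → Submodule ℂ W := fun μ => End.eigenspace A μ
  have h1 : iSupIndep F := (End.eigenspaces_iSupIndep A).comp Subtype.val_injective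
  have h2 : iSup F = ⊤ := by
    rw [eq_top_iff, ← iSup_eigenspace_eq_top_of_separable hq hA]
    refine iSup_le fun μ => ?_
    by_cases hμ : q.IsRoot μ
    · exact le_iSup F ⟨μ, by simpa [hq0] using hμ⟩
    · rw [eigenspace_eq_bot_of_not_isRoot hA hμ]
      exact bot_le
  have h3 := DirectSum.isInternal_submodule_of_iSupIndep_of_iSup_eq_top h1 h2
  have h4 : q.roots.toFinset.card = q.natDegree := by
    rw [Multiset.toFinset_card_of_nodup (Polynomial.nodup_roots hq),
      (IsAlgClosed.splits q).natDegree_eq_card_roots]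
  rw [← (LinearEquiv.ofBijective (DirectSum.coeLinearMap F) h3).finrank_eq,
    finrank_directSum, Finset.sum_congr rfl (g := fun _ => α), Finset.sum_const,
    Finset.card_univ, Fintype.card_coe, h4, smul_eq_mul]
  intro μ _
  exact hα μ (Polynomial.isRoot_of_mem_roots (Multiset.mem_toFinset.mp μ.2))

/-- Lagrange interpolation: `∑ h_w(A) / h_w(w)` over the roots is the identity on each eigenspace,
and the eigenspaces span. -/
theorem eq_zero_of_forall_aeval_eq_zero {A : End ℂ W} {q : ℂ[X]} (hq : q.Separable)
    (hA : Polynomial.aeval A q = 0) {h : ℂ → ℂ[X]}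
    (hh : ∀ w, q.IsRoot w → h w * (Polynomial.X - Polynomial.C w) = q) {u : W}
    (hu : ∀ w, q.IsRoot w → Polynomial.aeval A (h w) u = 0) : u = 0 := by
  have hq0 : q ≠ 0 := hq.ne_zero
  have hroot : ∀ w, w ∈ q.roots.toFinset ↔ q.IsRoot w := by simp [hq0]
  let L : End ℂ W := ∑ w ∈ q.roots.toFinset, ((h w).eval w)⁻¹ • Polynomial.aeval A (h w)
  have hL : (⊤ : Submodule ℂ W) ≤ LinearMap.eqLocus L LinearMap.id := by
    rw [← iSup_eigenspace_eq_top_of_separable hq hA]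
    refine iSup_le fun μ v hv => ?_
    by_cases hμ : q.IsRoot μ
    · rw [LinearMap.mem_eqLocus, LinearMap.sum_apply, Finset.sum_eq_single μ]
      · rw [LinearMap.smul_apply, aeval_apply_of_mem_eigenspace hv,
          inv_smul_smul₀ (eval_ne_zero_of_mul_eq hq (hh μ hμ)), LinearMap.id_apply]
      · intro w hw hwμ
        have h1 : (h w).eval μ = 0 := by
          have h2 : (h w * (Polynomial.X - Polynomial.C w)).eval μ = 0 := by
            rw [hh w ((hroot w).mp hw)]; exact hμ
          rw [Polynomial.eval_mul, Polynomial.eval_sub, Polynomial.eval_X, Polynomial.eval_C] at h2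
          exact (mul_eq_zero.mp h2).resolve_right (sub_ne_zero.mpr hwμ.symm)
        rw [LinearMap.smul_apply, aeval_apply_of_mem_eigenspace hv, h1, zero_smul, smul_zero]
      · intro h1
        exact absurd ((hroot μ).mpr hμ) h1
    · rw [eigenspace_eq_bot_of_not_isRoot hA hμ, Submodule.mem_bot] at hv
      rw [hv]
      exact Submodule.zero_mem _
  have h1 : L u = u := hL Submodule.mem_top
  rw [← h1, LinearMap.sum_apply]
  refine Finset.sum_eq_zero fun w hw => ?_
  rw [LinearMap.smul_apply, hu w ((hroot w).mp hw), smul_zero]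

end Resolvent

/-! ### Rationality of evaluation on `ker T*`. -/

section Rational

open ContinuousLinearMap
open scoped InnerProduct Polynomial

variable {H : Type*} [NormedAddCommGroup H] [InnerProductSpace ℂ H] [CompleteSpace H]

theorem adjoint_mem_wandering {S T : H →L[ℂ] H} (hST : S * T = T * S) {f : H}
    (hf : f ∈ wandering T) : (S†) f ∈ wandering T := by
  rw [mem_wandering] at hf ⊢
  have h : (S * T)† = (T * S)† := by rw [hST]
  have h2 := congrArg (fun A : H →L[ℂ] H => A f) h
  rw [← star_eq_adjoint, ← star_eq_adjoint, star_mul, star_mul] at h2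
  simp only [mul_apply_comp, star_eq_adjoint] at h2
  rw [h2, hf, map_zero]

theorem exists_polynomial_adjugate {n : ℕ} (M : Matrix (Fin n) (Fin n) ℂ) :
    ∃ (d : ℂ[X]) (B : Matrix (Fin n) (Fin n) ℂ[X]), ∀ z, d.eval z = (1 - z • M).det ∧
      ∀ i j, (B i j).eval z = (1 - z • M).adjugate i j := by
  let N : Matrix (Fin n) (Fin n) ℂ[X] := 1 - (Polynomial.X : ℂ[X]) • M.map Polynomial.C
  have hN : ∀ z, (Polynomial.evalRingHom z).mapMatrix N = 1 - z • M := by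
    intro z
    rw [map_sub, map_one]
    congr 1
    ext i j
    simp
    ring
  refine ⟨N.det, N.adjugate, fun z => ⟨?_, fun i j => ?_⟩⟩
  · rw [← hN, ← RingHom.map_det, Polynomial.coe_evalRingHom]
  · rw [← hN, ← RingHom.map_adjugate]
    rfl

/-- On the finite-dimensional, `S*`-invariant space `ker T*` the operator `1 - z S*` is a matrix,
inverted by Cramer's rule. The denominator is its determinant, nonzero on the disk because `1 - z
S*` is invertible on `H`. -/
theorem IsPureIsometry.exists_denominator {S T : H →L[ℂ] H} (hS : IsPureIsometry S)
    (hST : S * T = T * S) [FiniteDimensional ℂ (wandering T)] :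
    ∃ d : ℂ[X], (∀ z, ‖z‖ < 1 → d.eval z ≠ 0) ∧ ∀ (f : wandering T) (c : wandering S),
      ∃ r : ℂ[X], ∀ z, ‖z‖ < 1 → r.eval z = d.eval z * inner ℂ c (hS.ev z f) := by
  let A : wandering T →ₗ[ℂ] wandering T :=
    (S†).toLinearMap.restrict fun f hf => adjoint_mem_wandering hST hf
  have hAcoe : ∀ v, (A v : H) = (S†) v := fun v => rfl
  clear_value A
  let b := Module.finBasis ℂ (wandering T)
  obtain ⟨d, N, hdN⟩ := exists_polynomial_adjugate (LinearMap.toMatrix b b A)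
  have hM : ∀ z : ℂ, 1 - z • LinearMap.toMatrix b b A = LinearMap.toMatrix b b (1 - z • A) := by
    intro z
    rw [map_sub, map_smul, LinearMap.toMatrix_one]
  refine ⟨d, fun z hz => ?_, fun f c => ?_⟩
  · rw [(hdN z).1, hM, LinearMap.det_toMatrix, ← isUnit_iff_ne_zero,
      ← LinearMap.isUnit_iff_isUnit_det, LinearMap.isUnit_iff_ker_eq_bot, LinearMap.ker_eq_bot']
    intro v hv
    have h1 : ((1 : H →L[ℂ] H) - z • S†) v = 0 := by
      have := congrArg Subtype.val hv
      simpa [hAcoe] using this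
    have h2 := congrArg (fun B : H →L[ℂ] H => B v)
      (Ring.inverse_mul_cancel _ (hS.isUnit_one_sub hz))
    simp only [mul_apply_comp, h1, map_zero] at h2
    exact Subtype.ext h2.symm
  · refine ⟨∑ i, ∑ j, Polynomial.C (inner ℂ c (hS.proj (b i))) *
      (N i j * Polynomial.C (b.repr f j)), fun z hz => ?_⟩
    set g := Matrix.toLin b b (1 - z • LinearMap.toMatrix b b A).adjugate f with hg
    have h1 : g - z • A g = d.eval z • f := by
      have h2 : Matrix.toLin b b ((1 - z • LinearMap.toMatrix b b A) *
          (1 - z • LinearMap.toMatrix b b A).adjugate) f = d.eval z • f := by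
        rw [Matrix.mul_adjugate, map_smul, Matrix.toLin_one, (hdN z).1]
        rfl
      rw [Matrix.toLin_mul b b b, hM, Matrix.toLin_toMatrix, ← hM] at h2
      exact h2
    have h2 : (g : H) - z • (S†) g = d.eval z • (f : H) := by
      rw [← hAcoe]
      exact congrArg Subtype.val h1
    have h3 : d.eval z • hS.ev z f = hS.proj g := by
      rw [← map_smul, ← h2, hS.ev_sub hz]
    have h5 : (g : H) = ∑ i, ∑ j, ((1 - z • LinearMap.toMatrix b b A).adjugate i j *
        b.repr f j) • (b i : H) := by
      rw [hg, Matrix.toLin_apply, Submodule.coe_sum]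
      simp only [Submodule.coe_sum, Submodule.coe_smul, Matrix.mulVec, dotProduct, Finset.sum_smul]
    rw [← inner_smul_right, h3, h5]
    simp only [map_sum, map_smul, inner_sum, inner_smul_right, Polynomial.eval_finsetSum,
      Polynomial.eval_mul, Polynomial.eval_C, (hdN z).2]
    refine Finset.sum_congr rfl fun i _ => Finset.sum_congr rfl fun j _ => ?_
    ring

end Rational

/-! ### The dimension of `ker S*`. -/

section FiniteRank

open Filter Topology

theorem eventually_eval_ne_zero {r : Polynomial ℂ} (hr : r ≠ 0) (a : ℂ) :
    ∀ᶠ z in 𝓝[≠] a, r.eval z ≠ 0 := by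
  have h : ((r.roots.toFinset : Set ℂ) \ {a})ᶜ ∈ 𝓝 a :=
    ((r.roots.toFinset.finite_toSet.subset Set.sdiff_subset).isClosed.isOpen_compl).mem_nhds
      (by simp)
  filter_upwards [nhdsWithin_le_nhds h, self_mem_nhdsWithin] with z hz hza h0
  exact hz ⟨by simpa [hr] using h0, hza⟩

theorem eventually_norm_lt_one : ∀ᶠ z in 𝓝[≠] (0 : ℂ), ‖z‖ < 1 := by
  refine eventually_nhdsWithin_of_eventually_nhds ?_
  filter_upwards [Metric.ball_mem_nhds (0 : ℂ) one_pos] with z hz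
  simpa using hz

variable {H : Type*} [NormedAddCommGroup H] [InnerProductSpace ℂ H] [CompleteSpace H]
  {p : MvPolynomial (Fin 2) ℂ} {S T : H →L[ℂ] H} {α : ℕ}

theorem IsPureIsopair.finrank_eigenspace_symbol (hpt : IsInnerToral p) (hV : IsPureIsopair p S T)
    (hα : HasRank p S T α) [FiniteDimensional ℂ (wandering S)] {z : ℂ} (hz : ‖z‖ < 1)
    (hs : (fiber z p).Separable) {w : ℂ} (hw : (fiber z p).IsRoot w) :
    Module.finrank ℂ (Module.End.eigenspace (hV.left.symbol T z) w) = α := by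
  rw [← hV.left.finrank_jointKer hV.comm (x := (z, w)) hz]
  exact Module.finrank_eq_of_rank_eq
    (hα.2 (z, w) (hpt.mem_variety hz hw) (isRegularPoint_of_separable hs hw))

theorem IsPureIsopair.finrank_wandering (hp : Irreducible p) (hpt : IsInnerToral p)
    (hV : IsPureIsopair p S T) (hα : HasRank p S T α) [FiniteDimensional ℂ (wandering S)] :
    Module.finrank ℂ (wandering S) = p.degreeOf 1 * α := by
  obtain ⟨r, hr0, hr⟩ := exists_separable_fiber hp (hpt.degreeOf_one_ne_zero hp)
  obtain ⟨z, hz, hz1⟩ := ((eventually_eval_ne_zero hr0 0).and eventually_norm_lt_one).exists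
  obtain ⟨hdeg, hsep⟩ := hr z hz
  rw [← hdeg]
  exact finrank_eq_natDegree_mul hsep (hV.aeval_symbol hz1)
    fun μ hμ => hV.finrank_eigenspace_symbol hpt hα hz1 hsep hμ

end FiniteRank

/-! ### The difference quotient of `p` and its matrix version. -/

section Quotient

/-- The difference quotient `(p(z,X) - p(z,w)) / (X - w)`. -/
noncomputable def fiberQuotient (p : MvPolynomial (Fin 2) ℂ) (x : ℂ × ℂ) : Polynomial ℂ :=
  ∑ d ∈ p.support, ∑ a ∈ Finset.range (d 1),
    (p.coeff d * x.1 ^ d 0 * x.2 ^ (d 1 - 1 - a)) • Polynomial.X ^ a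

theorem fiberQuotient_mul {p : MvPolynomial (Fin 2) ℂ} {z w : ℂ} (hw : (fiber z p).IsRoot w) :
    fiberQuotient p (z, w) * (Polynomial.X - Polynomial.C w) = fiber z p := by
  have h1 : fiberQuotient p (z, w) * (Polynomial.X - Polynomial.C w) =
      fiber z p - Polynomial.C ((fiber z p).eval w) := by
    rw [fiber_eq_sum, fiberQuotient, Finset.sum_mul, Polynomial.eval_finsetSum, map_sum,
      ← Finset.sum_sub_distrib]
    refine Finset.sum_congr rfl fun d _ => ?_
    have h2 := (Commute.all (Polynomial.X : Polynomial ℂ) (Polynomial.C w)).geom_sum₂_mul (d 1)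
    rw [Polynomial.eval_smul, Polynomial.eval_pow, Polynomial.eval_X, smul_eq_mul,
      Polynomial.C_mul, Polynomial.C_pow, ← Polynomial.smul_eq_C_mul, ← smul_sub, ← h2,
      ← smul_mul_assoc, Finset.smul_sum]
    congr 1
    refine Finset.sum_congr rfl fun a _ => ?_
    simp only [Polynomial.smul_eq_C_mul, map_mul, map_pow]
    ring
  rw [h1, hw.eq_zero, map_zero, sub_zero]

/-- The matrix polynomial `D ^ (m - 1) (p(z,Φ) - p(z,w)) / (Φ - w)` for `Φ = F / D`, where `m` is
the degree of `p` in `w`. -/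
noncomputable def matQuotient {M : ℕ} (p D : MvPolynomial (Fin 2) ℂ)
    (F : Matrix (Fin M) (Fin M) (MvPolynomial (Fin 2) ℂ)) :
    Matrix (Fin M) (Fin M) (MvPolynomial (Fin 2) ℂ) :=
  ∑ d ∈ p.support, ∑ a ∈ Finset.range (d 1),
    (C (p.coeff d) * X 0 ^ d 0 * X 1 ^ (d 1 - 1 - a) * D ^ (p.degreeOf 1 - 1 - a)) • F ^ a

theorem matEval_eq_mapMatrix {M : ℕ} (A : Matrix (Fin M) (Fin M) (MvPolynomial (Fin 2) ℂ))
    (x : ℂ × ℂ) : matEval A x = (evalAt x).mapMatrix A := rfl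

theorem matEval_matQuotient {M : ℕ} {p D : MvPolynomial (Fin 2) ℂ}
    {F : Matrix (Fin M) (Fin M) (MvPolynomial (Fin 2) ℂ)} {x : ℂ × ℂ}
    {Φ : Matrix (Fin M) (Fin M) ℂ} (h : matEval F x = evalAt x D • Φ) :
    matEval (matQuotient p D F) x =
      evalAt x D ^ (p.degreeOf 1 - 1) • Polynomial.aeval Φ (fiberQuotient p x) := by
  rw [matEval_eq_mapMatrix] at h ⊢
  have hsmul : ∀ (c : MvPolynomial (Fin 2) ℂ) (A : Matrix (Fin M) (Fin M) (MvPolynomial (Fin 2) ℂ)),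
      (evalAt x).mapMatrix (c • A) = evalAt x c • (evalAt x).mapMatrix A := by
    intro c A
    ext i j
    simp
  simp only [matQuotient, fiberQuotient, map_sum, hsmul, map_pow, h, Finset.smul_sum, map_smul,
    Polynomial.aeval_X, smul_pow, smul_smul, map_mul]
  refine Finset.sum_congr rfl fun d hd => Finset.sum_congr rfl fun a ha => ?_
  have h1 : d 1 ≤ p.degreeOf 1 := monomial_le_degreeOf 1 hd
  have h2 : a < d 1 := Finset.mem_range.mp ha
  congr 1
  -- Since `a < d 1 ≤ m`, the truncated subtractions are exact; `Φ ^ a` uses `a` of the `m - 1`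
  -- factors of `D`.
  have h3 : p.degreeOf 1 - 1 = (p.degreeOf 1 - 1 - a) + a := by omega
  conv_rhs => rw [h3, pow_add]
  simp [evalAt]
  ring

end Quotient

/-! ### Compressing a matrix of rank `α` to `α` rows. -/

section Compression

variable {α M : ℕ}

theorem Matrix.exists_mul_mul_eq_one {G : Matrix (Fin M) (Fin M) ℂ} (hG : G.rank = α) :
    ∃ (C : Matrix (Fin α) (Fin M) ℂ) (L : Matrix (Fin M) (Fin α) ℂ), C * G * L = 1 := by
  have e : LinearMap.range G.mulVecLin ≃ₗ[ℂ] (Fin α → ℂ) :=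
    LinearEquiv.ofFinrankEq _ _ (by rw [Module.finrank_fin_fun]; exact hG)
  obtain ⟨c, hc⟩ := LinearMap.exists_extend e.toLinearMap
  obtain ⟨l, hl⟩ := G.mulVecLin.rangeRestrict.exists_rightInverse_of_surjective
    G.mulVecLin.range_rangeRestrict
  refine ⟨LinearMap.toMatrix' c, LinearMap.toMatrix' (l ∘ₗ e.symm.toLinearMap), ?_⟩
  have h : c ∘ₗ G.mulVecLin ∘ₗ l ∘ₗ e.symm.toLinearMap = LinearMap.id := by
    refine LinearMap.ext fun v => ?_
    have h1 : ∀ v, G.mulVecLin (l v) = v := fun v =>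
      congrArg Subtype.val (congrArg (fun f => f v) hl)
    have h2 : ∀ v : LinearMap.range G.mulVecLin, c (v : Fin M → ℂ) = e v :=
      fun v => congrArg (fun f => f v) hc
    simp only [LinearMap.comp_apply, LinearEquiv.coe_coe, h1, h2, LinearEquiv.apply_symm_apply,
      LinearMap.id_apply]
  have h2 := congrArg LinearMap.toMatrix' h
  have h3 : LinearMap.toMatrix' G.mulVecLin = G := LinearMap.toMatrix'_toLin' G
  rw [LinearMap.toMatrix'_comp, LinearMap.toMatrix'_comp, LinearMap.toMatrix'_id, h3,
    ← Matrix.mul_assoc] at h2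
  exact h2

/-- The determinant condition makes `C` map the range of `G` onto `ℂ^α`; the dimensions agree, so
`C` is injective on that range. -/
theorem Matrix.mulVec_eq_zero_of_det_ne_zero {G : Matrix (Fin M) (Fin M) ℂ} (hG : G.rank = α)
    {C : Matrix (Fin α) (Fin M) ℂ} {L : Matrix (Fin M) (Fin α) ℂ} (h : (C * G * L).det ≠ 0)
    {u : Fin M → ℂ} (hu : C *ᵥ (G *ᵥ u) = 0) : G *ᵥ u = 0 := by
  let c : LinearMap.range G.mulVecLin →ₗ[ℂ] (Fin α → ℂ) :=
    C.mulVecLin ∘ₗ (LinearMap.range G.mulVecLin).subtype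
  have hsurj : Function.Surjective c := by
    intro v
    refine ⟨⟨G *ᵥ (L *ᵥ ((C * G * L)⁻¹ *ᵥ v)), _, rfl⟩, ?_⟩
    have h1 : (C * G * L) * (C * G * L)⁻¹ = 1 := Matrix.mul_nonsing_inv _ (Ne.isUnit h)
    simp only [c, LinearMap.comp_apply, Submodule.subtype_apply, Matrix.mulVecLin_apply,
      Matrix.mulVec_mulVec]
    rw [← Matrix.mul_assoc G, ← Matrix.mul_assoc C, ← Matrix.mul_assoc C, h1, Matrix.one_mulVec]
  have hinj : Function.Injective c :=
    (LinearMap.injective_iff_surjective_of_finrank_eq_finrank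
      (by rw [Module.finrank_fin_fun]; exact hG)).mpr hsurj
  have h2 : (⟨G *ᵥ u, u, rfl⟩ : LinearMap.range G.mulVecLin) = 0 :=
    hinj (by rw [map_zero]; exact hu)
  exact congrArg Subtype.val h2

end Compression

/-! ### Polynomial form of the symbol and construction of `Q`. -/

section Frame

open Filter Topology ContinuousLinearMap
open scoped InnerProduct Polynomial

variable {H : Type*} [NormedAddCommGroup H] [InnerProductSpace ℂ H] [CompleteSpace H]
  {p : MvPolynomial (Fin 2) ℂ} {S T : H →L[ℂ] H} {α : ℕ}

/-- A polynomial in `z`, regarded as a polynomial in `z` and `w`. -/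
noncomputable def ofFst : ℂ[X] →ₐ[ℂ] MvPolynomial (Fin 2) ℂ := Polynomial.aeval (X 0)

theorem evalAt_ofFst (x : ℂ × ℂ) (r : ℂ[X]) : evalAt x (ofFst r) = r.eval x.1 := by
  have : (evalAt x).comp (ofFst : ℂ[X] →+* _) = Polynomial.evalRingHom x.1 := by
    apply Polynomial.ringHom_ext <;> simp [evalAt, ofFst]
  exact congrArg (fun f => f r) this

theorem evalAt_C (x : ℂ × ℂ) (a : ℂ) : evalAt x (C a) = a := eval_C a

theorem matEval_mul {a b c : ℕ} (A : Matrix (Fin a) (Fin b) (MvPolynomial (Fin 2) ℂ))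
    (B : Matrix (Fin b) (Fin c) (MvPolynomial (Fin 2) ℂ)) (x : ℂ × ℂ) :
    matEval (A * B) x = matEval A x * matEval B x := Matrix.map_mul

theorem matEval_map_C {a b : ℕ} (A : Matrix (Fin a) (Fin b) ℂ) (x : ℂ × ℂ) :
    matEval (A.map C) x = A := by
  ext i j
  simp [matEval, evalAt_C]

theorem matEval_smul {a b : ℕ} (c : MvPolynomial (Fin 2) ℂ)
    (A : Matrix (Fin a) (Fin b) (MvPolynomial (Fin 2) ℂ)) (x : ℂ × ℂ) :
    matEval (c • A) x = evalAt x c • matEval A x := by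
  ext i j
  simp [matEval]

theorem IsPureIsopair.exists_polynomial_symbol (hV : IsPureIsopair p S T)
    [FiniteDimensional ℂ (wandering T)] {M : ℕ} (b : OrthonormalBasis (Fin M) ℂ (wandering S)) :
    ∃ (d : ℂ[X]) (F : Matrix (Fin M) (Fin M) (MvPolynomial (Fin 2) ℂ)),
      (∀ z, ‖z‖ < 1 → d.eval z ≠ 0) ∧
      (∀ x : ℂ × ℂ, ‖x.1‖ < 1 → matEval F x = evalAt x (ofFst d) •
        LinearMap.toMatrixAlgEquiv b.toBasis (hV.left.symbol T x.1)) ∧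
      ∀ (f : wandering T) (i : Fin M), ∃ r : MvPolynomial (Fin 2) ℂ, ∀ x : ℂ × ℂ, ‖x.1‖ < 1 →
        evalAt x r = evalAt x (ofFst d) * b.toBasis.repr (hV.left.ev x.1 f) i := by
  obtain ⟨d, hd, hdr⟩ := hV.left.exists_denominator hV.comm
  choose r hr using hdr
  -- For `c` in `ker S*`, `T c` splits into a constant in `ker S*` plus `S (S* T c)`. The vector `S*
  -- T c` lies in `ker T*`, where evaluation is rational.
  have hmem : ∀ c : wandering S, (S†) (T c) ∈ wandering T := by
    intro c
    have h1 : (T†) ((S†) (T c)) = (S†) ((T†) (T c)) := by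
      have h := congrArg (fun A : H →L[ℂ] H => (A†) (T c)) hV.comm
      simp only [← star_eq_adjoint, star_mul] at h
      exact h
    rw [mem_wandering, h1, hV.right.adjoint_apply_apply]
    exact c.2
  refine ⟨d, Matrix.of fun i j => ofFst
    (Polynomial.C (inner ℂ (b i) (hV.left.proj (T (b j)))) * d +
      Polynomial.X * r ⟨_, hmem (b j)⟩ (b i)), hd, fun x hx => ?_, fun f i => ?_⟩
  · ext i j
    have h1 : T (b j) = hV.left.proj (T (b j)) + S ((S†) (T (b j))) := by
      rw [hV.left.coe_proj, sub_add_cancel]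
    have h2 : hV.left.symbol T x.1 (b j) =
        hV.left.proj (T (b j)) + x.1 • hV.left.ev x.1 ((S†) (T (b j))) := by
      rw [hV.left.symbol_apply]
      conv_lhs => rw [h1]
      rw [map_add, hV.left.ev_coe hx, hV.left.ev_apply hx]
    rw [Matrix.smul_apply, LinearMap.toMatrixAlgEquiv_apply, OrthonormalBasis.coe_toBasis, h2,
      OrthonormalBasis.coe_toBasis_repr_apply, b.repr_apply_apply, inner_add_right,
      inner_smul_right]
    simp only [matEval, Matrix.map_apply, Matrix.of_apply, evalAt_ofFst, Polynomial.eval_add,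
      Polynomial.eval_mul, Polynomial.eval_C, Polynomial.eval_X, hr _ _ _ hx, smul_eq_mul]
    ring
  · refine ⟨ofFst (r f (b i)), fun x hx => ?_⟩
    rw [evalAt_ofFst, evalAt_ofFst, hr _ _ _ hx, OrthonormalBasis.coe_toBasis_repr_apply,
      b.repr_apply_apply]

theorem IsPureIsopair.exists_polynomial_frame (hp : Irreducible p) (hpt : IsInnerToral p)
    (hV : IsPureIsopair p S T) (hα : HasRank p S T α) [FiniteDimensional ℂ (wandering S)]
    [FiniteDimensional ℂ (wandering T)] {M : ℕ} (b : OrthonormalBasis (Fin M) ℂ (wandering S)) :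
    ∃ Q : Matrix (Fin α) (Fin M) (MvPolynomial (Fin 2) ℂ),
      (∀ x ∈ variety p, ∀ f, matEval Q x *ᵥ b.toBasis.repr (hV.left.ev x.1 (T f)) =
        x.2 • (matEval Q x *ᵥ b.toBasis.repr (hV.left.ev x.1 f))) ∧
      (∃ x ∈ variety p, Function.Surjective (matEval Q x).mulVec) ∧
      (∀ f, (∀ x ∈ variety p, matEval Q x *ᵥ b.toBasis.repr (hV.left.ev x.1 f) = 0) → f = 0) ∧
      ∀ (f : wandering T) (i : Fin α), ∃ r : MvPolynomial (Fin 2) ℂ, ∀ x ∈ variety p,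
        evalAt x r = (matEval Q x *ᵥ b.toBasis.repr (hV.left.ev x.1 f)) i := by
  obtain ⟨d, F, hd, hF, hr⟩ := hV.exists_polynomial_symbol b
  have hm := hpt.degreeOf_one_ne_zero hp
  obtain ⟨s, hs0, hs⟩ := exists_separable_fiber hp hm
  set B := b.toBasis
  set Φ : ℂ → Matrix (Fin M) (Fin M) ℂ :=
    fun z => LinearMap.toMatrixAlgEquiv B (hV.left.symbol T z) with hΦ
  set G := matQuotient p (ofFst d) F
  set δ : ℂ → ℂ := fun z => d.eval z ^ (p.degreeOf 1 - 1) with hδ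
  have hδ0 : ∀ z, ‖z‖ < 1 → δ z ≠ 0 := fun z hz => pow_ne_zero _ (hd z hz)
  have hG0 : ∀ x : ℂ × ℂ, ‖x.1‖ < 1 →
      matEval G x = δ x.1 • Polynomial.aeval (Φ x.1) (fiberQuotient p x) := by
    intro x hx
    rw [matEval_matQuotient (hF x hx), evalAt_ofFst]
  have hG : ∀ x : ℂ × ℂ, ‖x.1‖ < 1 → matEval G x = δ x.1 •
      LinearMap.toMatrixAlgEquiv B
        (Polynomial.aeval (hV.left.symbol T x.1) (fiberQuotient p x)) := by
    intro x hx
    rw [hG0 x hx, hΦ]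
    congr 1
    exact Polynomial.aeval_algHom_apply (LinearMap.toMatrixAlgEquiv B).toAlgHom _ _
  have hGv : ∀ x : ℂ × ℂ, ‖x.1‖ < 1 → ∀ v, matEval G x *ᵥ B.repr v = δ x.1 •
      B.repr (Polynomial.aeval (hV.left.symbol T x.1) (fiberQuotient p x) v) := by
    intro x hx v
    rw [hG x hx, Matrix.smul_mulVec]
    congr 1
    exact LinearMap.toMatrix_mulVec_repr B B _ v
  have hrank : ∀ z w : ℂ, ‖z‖ < 1 → s.eval z ≠ 0 → (fiber z p).IsRoot w →
      (matEval G (z, w)).rank = α := by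
    intro z w hz hsz hw
    rw [hG (z, w) hz,
      Matrix.rank_smul_of_mem_nonZeroDivisors _ (mem_nonZeroDivisors_of_ne_zero (hδ0 z hz)),
      Matrix.rank_eq_finrank_range_toLin _ B B]
    have h1 : Matrix.toLin B B (LinearMap.toMatrixAlgEquiv B
        (Polynomial.aeval (hV.left.symbol T z) (fiberQuotient p (z, w)))) =
        Polynomial.aeval (hV.left.symbol T z) (fiberQuotient p (z, w)) :=
      Matrix.toLin_toMatrix B B _
    rw [h1, range_aeval_eq_eigenspace (hs z hsz).2 (hV.aeval_symbol hz) (fiberQuotient_mul hw),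
      hV.finrank_eigenspace_symbol hpt hα hz (hs z hsz).2 hw]
  obtain ⟨z₀, hz₀, hz₀1⟩ := ((eventually_eval_ne_zero hs0 0).and eventually_norm_lt_one).exists
  obtain ⟨w₀, hw₀⟩ : ∃ w₀, (fiber z₀ p).IsRoot w₀ := by
    apply IsAlgClosed.exists_root
    intro h
    exact hm (by rw [← (hs z₀ hz₀).1, Polynomial.natDegree_eq_zero_iff_degree_le_zero.mpr h.le])
  have hx₀ := hpt.mem_variety hz₀1 hw₀
  -- The constant compression is normalized at one generic point, where `c G l = 1`.
  obtain ⟨c, l, hcl⟩ := Matrix.exists_mul_mul_eq_one (hrank z₀ w₀ hz₀1 hz₀ hw₀)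
  let c' : Matrix (Fin α) (Fin M) (MvPolynomial (Fin 2) ℂ) := c.map C
  let l' : Matrix (Fin M) (Fin α) (MvPolynomial (Fin 2) ℂ) := l.map C
  set q : MvPolynomial (Fin 2) ℂ := (c' * G * l').det
  have hq : ∀ x, evalAt x q = (c * matEval G x * l).det := by
    intro x
    have h1 : matEval (c' * G * l') x = c * matEval G x * l := by
      rw [matEval_mul, matEval_mul, matEval_map_C, matEval_map_C]
    rw [← h1, RingHom.map_det]
    rfl
  have hpq : ¬ p ∣ q := by
    rintro ⟨k, hk⟩
    have h1 := hq (z₀, w₀)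
    rw [hcl, Matrix.det_one, hk, map_mul, hx₀.1, zero_mul] at h1
    exact zero_ne_one h1
  -- `det (c G l)` is `1` at the base point, so `p` does not divide it: on the variety it vanishes
  -- over finitely many `z` only.
  obtain ⟨e, he0, he⟩ := exists_eliminant hp hm hpq
  -- The extra factor `d` clears the denominator of evaluation on `ker T*`, so that `P` will be
  -- polynomial as well.
  set Q := ofFst d • (c' * G) with hQdef
  have hQ : ∀ x u, matEval Q x *ᵥ u = d.eval x.1 • (c *ᵥ (matEval G x *ᵥ u)) := by
    intro x u
    rw [hQdef, matEval_smul, matEval_mul, matEval_map_C, evalAt_ofFst, Matrix.smul_mulVec,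
      Matrix.mulVec_mulVec]
  refine ⟨Q, fun x hx f => ?_, ⟨(z₀, w₀), hx₀, fun v => ?_⟩, fun f hf => ?_, fun f i => ?_⟩
  · have hw : (fiber x.1 p).IsRoot x.2 := by
      rw [Polynomial.IsRoot, eval_fiber]
      exact hx.1
    have h1 : ∀ v, Polynomial.aeval (hV.left.symbol T x.1) (fiberQuotient p x)
        (hV.left.symbol T x.1 v) =
        x.2 • Polynomial.aeval (hV.left.symbol T x.1) (fiberQuotient p x) v := by
      intro v
      have h2 := hV.aeval_symbol hx.2.1
      rw [← fiberQuotient_mul hw, map_mul] at h2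
      have h3 := congrArg (fun A : Module.End ℂ (wandering S) => A v) h2
      rw [← sub_eq_zero, ← map_smul, ← map_sub]
      simpa using h3
    rw [hQ, hQ, hV.left.ev_comm_symbol hV.comm hx.2.1, hGv x hx.2.1, hGv x hx.2.1, h1, map_smul,
      Finsupp.coe_smul, smul_comm (δ x.1), Matrix.mulVec_smul, smul_comm (d.eval x.1)]
  · refine ⟨(d.eval z₀)⁻¹ • (l *ᵥ v), ?_⟩
    rw [hQ, Matrix.mulVec_smul, Matrix.mulVec_smul, smul_inv_smul₀ (hd z₀ hz₀1),
      Matrix.mulVec_mulVec, Matrix.mulVec_mulVec, hcl, Matrix.one_mulVec]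
  · apply hV.left.eq_zero_of_eventually_ev
    -- For generic small `z`, the compression is injective on the range of `G(z, w)` at every root
    -- `w`, so all the `h_w(Φ(z))` kill `f(z)` and interpolation gives `f(z) = 0`.
    filter_upwards [eventually_eval_ne_zero hs0 0, eventually_eval_ne_zero he0 0,
      eventually_norm_lt_one] with z hsz hez hz
    refine eq_zero_of_forall_aeval_eq_zero (hs z hsz).2 (hV.aeval_symbol hz)
      (h := fun w => fiberQuotient p (z, w)) (fun w hw => fiberQuotient_mul hw) fun w hw => ?_
    have hx := hpt.mem_variety hz hw
    have h1 := hf _ hx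
    rw [hQ] at h1
    have h2 := (smul_eq_zero.mp h1).resolve_left (hd z hz)
    have h3 : (c * matEval G (z, w) * l).det ≠ 0 := by
      rw [← hq]
      exact fun h => hez (he _ hx.1 h)
    have h4 := Matrix.mulVec_eq_zero_of_det_ne_zero (hrank z w hz hsz hw) h3 h2
    rw [hGv (z, w) hz] at h4
    have h5 := (smul_eq_zero.mp h4).resolve_left (hδ0 z hz)
    exact (LinearEquiv.map_eq_zero_iff B.repr).mp (DFunLike.coe_injective h5)
  · choose r hr using hr f
    refine ⟨∑ k, (c' * G) i k * r k, fun x hx => ?_⟩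
    rw [hQdef, matEval_smul, evalAt_ofFst, Matrix.smul_mulVec, map_sum]
    simp only [map_mul, hr _ x hx.2.1, evalAt_ofFst, Pi.smul_apply, Matrix.mulVec, dotProduct,
      smul_eq_mul, Finset.mul_sum]
    refine Finset.sum_congr rfl fun k _ => ?_
    have h1 : evalAt x ((c' * G) i k) = matEval (c' * G) x i k := rfl
    rw [h1]
    ring

end Frame

/-! ### Unitaries from equal Gram matrices. -/

section Gram

open scoped InnerProduct

variable {E₁ E₂ : Type*} [NormedAddCommGroup E₁] [InnerProductSpace ℂ E₁] [CompleteSpace E₁]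
  [NormedAddCommGroup E₂] [InnerProductSpace ℂ E₂] [CompleteSpace E₂]

theorem denseRange_linearCombination {ι : Type*} {k : ι → E₁}
    (hk : ∀ f, (∀ i, inner ℂ (k i) f = 0) → f = 0) :
    DenseRange (Finsupp.linearCombination ℂ k) := by
  have h : ((LinearMap.range (Finsupp.linearCombination ℂ k))ᗮ : Submodule ℂ E₁) = ⊥ := by
    rw [Submodule.eq_bot_iff]
    intro f hf
    exact hk f fun i => hf _ ⟨Finsupp.single i 1, by simp⟩
  have h2 := (Submodule.dense_iff_topologicalClosure_eq_top).mpr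
    ((Submodule.topologicalClosure_eq_top_iff).mpr h)
  exact h2

/-- Equal Gram matrices make `∑ aᵢ k₁ᵢ ↦ ∑ aᵢ k₂ᵢ` isometric; trivial orthogonal complements make
both spans dense, so it extends to a unitary. -/
theorem exists_linearIsometryEquiv_of_gram_eq {ι : Type*} {k₁ : ι → E₁} {k₂ : ι → E₂}
    (h₁ : ∀ f, (∀ i, inner ℂ (k₁ i) f = 0) → f = 0)
    (h₂ : ∀ f, (∀ i, inner ℂ (k₂ i) f = 0) → f = 0)
    (h : ∀ i j, inner ℂ (k₁ i) (k₁ j) = inner ℂ (k₂ i) (k₂ j)) :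
    ∃ U : E₁ ≃ₗᵢ[ℂ] E₂, ∀ i, U (k₁ i) = k₂ i := by
  have hnorm : ∀ x : ι →₀ ℂ, ‖Finsupp.linearCombination ℂ k₂ (LinearEquiv.refl ℂ (ι →₀ ℂ) x)‖ =
      ‖Finsupp.linearCombination ℂ k₁ x‖ := by
    intro x
    rw [LinearEquiv.refl_apply, @norm_eq_sqrt_re_inner ℂ, @norm_eq_sqrt_re_inner ℂ]
    simp only [Finsupp.linearCombination_apply, Finsupp.sum, sum_inner, inner_sum,
      inner_smul_left, inner_smul_right, h]
  refine ⟨(LinearEquiv.refl ℂ (ι →₀ ℂ)).extendOfIsometry (Finsupp.linearCombination ℂ k₁)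
    (Finsupp.linearCombination ℂ k₂) (denseRange_linearCombination h₁)
    (denseRange_linearCombination h₂) hnorm, fun i => ?_⟩
  have := LinearEquiv.extendOfIsometry_eq (LinearEquiv.refl ℂ (ι →₀ ℂ)) _ _
    (denseRange_linearCombination h₁) (denseRange_linearCombination h₂) hnorm (Finsupp.single i 1)
  simpa using this

/-- The vectors `R_x* v` have the Gram matrix of the kernel functions of `H²(K)`; matching them
sends `f` to `x ↦ R_x f`. -/
theorem exists_linearIsometryEquiv_ofKernel {X V : Type*} [NormedAddCommGroup V]
    [InnerProductSpace ℂ V] [CompleteSpace V] {K : Matrix X X (V →L[ℂ] V)} [Fact K.PosSemidef]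
    (R : X → E₁ →L[ℂ] V) (hK : ∀ x y v, K x y v = R x (((R y)†) v))
    (hR : ∀ f, (∀ x, R x f = 0) → f = 0) :
    ∃ U : E₁ ≃ₗᵢ[ℂ] RKHS.OfKernel K, ∀ f x, U f x = R x f := by
  obtain ⟨U, hU⟩ := exists_linearIsometryEquiv_of_gram_eq
    (k₁ := fun i : X × V => ((R i.1)†) i.2)
    (k₂ := fun i : X × V => RKHS.kerFun (RKHS.OfKernel K) i.1 i.2)
    (fun f hf => hR f fun x => ext_inner_left ℂ fun v => by
      rw [← ContinuousLinearMap.adjoint_inner_left, hf (x, v), inner_zero_right])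
    (fun f hf => RKHS.ext fun x => ext_inner_left ℂ fun v => by
      rw [← RKHS.kerFun_inner, hf (x, v), RKHS.coe_zero, Pi.zero_apply, inner_zero_right])
    (fun i j => by
      rw [← RKHS.kernel_inner, RKHS.OfKernel.kernel_ofKernel, hK,
        ContinuousLinearMap.adjoint_inner_right])
  refine ⟨U, fun f x => ext_inner_left ℂ fun v => ?_⟩
  rw [← RKHS.kerFun_inner, ← hU (x, v), LinearIsometryEquiv.inner_map_map,
    ContinuousLinearMap.adjoint_inner_left]

end Gram

/-! ### The maps `f ↦ A f(z)` and their kernels. -/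

section Model

open ContinuousLinearMap
open scoped InnerProduct

variable {H : Type*} [NormedAddCommGroup H] [InnerProductSpace ℂ H] [CompleteSpace H]
  {p : MvPolynomial (Fin 2) ℂ} {S T : H →L[ℂ] H} {α M : ℕ}

/-- The map `f ↦ A f(z)`, where the values of `f` are expressed in an orthonormal basis. -/
noncomputable def IsPureIsometry.matEv (hS : IsPureIsometry S)
    (b : OrthonormalBasis (Fin M) ℂ (wandering S)) (A : Matrix (Fin α) (Fin M) ℂ) (z : ℂ) :
    H →L[ℂ] EuclideanSpace ℂ (Fin α) :=
  (Matrix.toEuclideanLin A).toContinuousLinearMap ∘L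
    (b.repr.toContinuousLinearEquiv : wandering S →L[ℂ] EuclideanSpace ℂ (Fin M)) ∘L hS.ev z

theorem IsPureIsometry.matEv_apply (hS : IsPureIsometry S)
    (b : OrthonormalBasis (Fin M) ℂ (wandering S)) (A : Matrix (Fin α) (Fin M) ℂ) (z : ℂ) (f : H) :
    hS.matEv b A z f = Matrix.toEuclideanLin A (b.repr (hS.ev z f)) := rfl

theorem IsPureIsometry.ofLp_matEv (hS : IsPureIsometry S)
    (b : OrthonormalBasis (Fin M) ℂ (wandering S)) (A : Matrix (Fin α) (Fin M) ℂ) (z : ℂ) (f : H) :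
    (hS.matEv b A z f).ofLp = A *ᵥ b.toBasis.repr (hS.ev z f) := by
  rw [hS.matEv_apply, Matrix.toLpLin_apply]
  congr 1

theorem IsPureIsometry.matEv_adjoint_matEv (hS : IsPureIsometry S)
    [FiniteDimensional ℂ (wandering S)]
    (b : OrthonormalBasis (Fin M) ℂ (wandering S)) (A B : Matrix (Fin α) (Fin M) ℂ) {z ζ : ℂ}
    (hz : ‖z‖ < 1) (hζ : ‖ζ‖ < 1) (u : EuclideanSpace ℂ (Fin α)) :
    hS.matEv b A z (((hS.matEv b B ζ)†) u) =
      Matrix.toEuclideanLin ((1 - z * conj ζ)⁻¹ • (A * Bᴴ)) u := by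
  have h1 : ((hS.matEv b B ζ)†) u =
      ((hS.ev ζ)†) (b.repr.symm (Matrix.toEuclideanLin Bᴴ u)) := by
    refine ext_inner_right ℂ fun f => ?_
    rw [adjoint_inner_left, adjoint_inner_left, hS.matEv_apply,
      Matrix.toEuclideanLin_conjTranspose_eq_adjoint, ← LinearIsometryEquiv.inner_map_map b.repr,
      LinearIsometryEquiv.apply_symm_apply, LinearMap.adjoint_inner_left]
  rw [h1, hS.matEv_apply, hS.ev_adjoint_ev hz hζ, map_smul, LinearIsometryEquiv.apply_symm_apply,
    map_smul, map_smul, LinearMap.smul_apply]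
  congr 1
  ext i
  simp [Matrix.toLpLin_apply, Matrix.mulVec_mulVec]

theorem Matrix.rank_eq_of_mulVec_surjective {a b : ℕ} {A : Matrix (Fin a) (Fin b) ℂ}
    (h : Function.Surjective A.mulVec) : A.rank = a := by
  rw [Matrix.rank, LinearMap.range_eq_top.mpr h, finrank_top, Module.finrank_fin_fun]

end Model

/-! ### Construction of the admissible triple. -/

section Triple

open ContinuousLinearMap
open scoped InnerProduct

variable {H : Type*} [NormedAddCommGroup H] [InnerProductSpace ℂ H] [CompleteSpace H]
  {p : MvPolynomial (Fin 2) ℂ} {S T : H →L[ℂ] H} {α : ℕ}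

theorem Irreducible.swapVars (hp : Irreducible p) : Irreducible (swapVars p) :=
  (MulEquiv.irreducible_iff _root_.swapVars).mpr hp

theorem IsPureIsopair.exists_admissibleTriple (hp : Irreducible p) (hpt : IsInnerToral p)
    (hV : IsPureIsopair p S T) (hα : HasRank p S T α) [FiniteDimensional ℂ (wandering S)]
    [FiniteDimensional ℂ (wandering T)] :
    ∃ (t : AdmissibleTriple p α) (R : variety p → H →L[ℂ] EuclideanSpace ℂ (Fin α)),
      (∀ x y v, t.kernel x y v = R x (((R y)†) v)) ∧ (∀ f, (∀ x, R x f = 0) → f = 0) ∧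
      (∀ x f, R x (S f) = x.1.1 • R x f) ∧ (∀ x f, R x (T f) = x.1.2 • R x f) := by
  have hM := hV.finrank_wandering hp hpt hα
  have hN := hV.swapVars.finrank_wandering
    hp.swapVars hpt.swapVars hα.swapVars
  rw [degreeOf_swapVars] at hN
  let b := (stdOrthonormalBasis ℂ (wandering S)).reindex (finCongr hM)
  let b' := (stdOrthonormalBasis ℂ (wandering T)).reindex (finCongr hN)
  obtain ⟨Q, hQT, ⟨x₀, hx₀, hQsurj⟩, hQinj, hQP⟩ := hV.exists_polynomial_frame hp hpt hα b
  choose r hr using hQP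
  -- The columns of `P` represent on the variety the values of `R_x` on an orthonormal basis of `ker
  -- T*`.
  let P : Matrix (Fin α) (Fin (p.degreeOf 0 * α)) (MvPolynomial (Fin 2) ℂ) :=
    Matrix.of fun i j => r (b' j) i
  let R : variety p → H →L[ℂ] EuclideanSpace ℂ (Fin α) :=
    fun x => hV.left.matEv b (matEval Q x.1) x.1.1
  have hRQ : ∀ x f, (R x f).ofLp = matEval Q x.1 *ᵥ b.toBasis.repr (hV.left.ev x.1.1 f) :=
    fun x f => hV.left.ofLp_matEv b _ _ f
  have hRS : ∀ x f, R x (S f) = x.1.1 • R x f := by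
    intro x f
    simp only [R, hV.left.matEv_apply, hV.left.ev_apply x.2.2.1, map_smul]
  have hRT : ∀ x f, R x (T f) = x.1.2 • R x f := by
    intro x f
    apply WithLp.ofLp_injective
    rw [WithLp.ofLp_smul, hRQ, hRQ, hQT _ x.2]
  have hRP : ∀ x, R x = hV.right.matEv b' (matEval P x.1) x.1.2 := by
    intro x
    ext1 f
    have hz := x.2.2.2
    -- In the model where `T` is the shift, `f - f(w)` lies in the range of `T - w`, which `R_x`
    -- kills; so `R_x f` depends on `f(w)` in `ker T*` only.
    have h0 : hV.right.ev x.1.2 (f - hV.right.ev x.1.2 f) = 0 := by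
      rw [map_sub, hV.right.ev_coe hz, sub_self]
    obtain ⟨g, hg⟩ := hV.right.exists_of_ev_eq_zero hz h0
    have h1 : R x f = R x (hV.right.ev x.1.2 f) := by
      rw [← sub_eq_zero, ← map_sub, hg, map_sub, hRT, map_smul, sub_self]
    rw [h1]
    apply WithLp.ofLp_injective
    rw [hV.right.ofLp_matEv]
    set c := hV.right.ev x.1.2 f
    have h2 : (c : H) = ∑ j, b'.toBasis.repr c j • (b' j : H) := by
      conv_lhs => rw [← b'.toBasis.sum_repr c]
      simp
    rw [h2, map_sum, WithLp.ofLp_sum]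
    ext i
    rw [Finset.sum_apply, Matrix.mulVec, dotProduct]
    refine Finset.sum_congr rfl fun j _ => ?_
    rw [map_smul, WithLp.ofLp_smul, Pi.smul_apply, hRQ, ← hr _ _ _ x.2, smul_eq_mul, mul_comm]
    rfl
  have hRR : ∀ (x y : variety p) u, R x (((R y)†) u) = Matrix.toEuclideanLin
      ((1 - x.1.1 * conj y.1.1)⁻¹ • (matEval Q x.1 * (matEval Q y.1)ᴴ)) u :=
    fun x y u => hV.left.matEv_adjoint_matEv b _ _ x.2.2.1 y.2.2.1 u
  have hRR' : ∀ (x y : variety p) u, R x (((R y)†) u) = Matrix.toEuclideanLin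
      ((1 - x.1.2 * conj y.1.2)⁻¹ • (matEval P x.1 * (matEval P y.1)ᴴ)) u := by
    intro x y u
    rw [hRP x, hRP y]
    exact hV.right.matEv_adjoint_matEv b' _ _ x.2.2.2 y.2.2.2 u
  have hRsurj : Function.Surjective (R ⟨x₀, hx₀⟩) := by
    intro v
    obtain ⟨u, hu⟩ := hQsurj v.ofLp
    refine ⟨(b.repr.symm (WithLp.toLp 2 u) : wandering S), WithLp.ofLp_injective _ ?_⟩
    rw [hRQ, hV.left.ev_coe hx₀.2.1, ← hu]
    congr 1
    ext i
    simp
  have hPsurj : Function.Surjective (matEval P x₀).mulVec := by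
    intro v
    obtain ⟨f, hf⟩ := hRsurj (WithLp.toLp 2 v)
    refine ⟨b'.toBasis.repr (hV.right.ev x₀.2 f), ?_⟩
    have h1 := congrArg WithLp.ofLp hf
    rw [hRP, hV.right.ofLp_matEv] at h1
    exact h1
  let t : AdmissibleTriple p α :=
    { K := fun x y => (1 - x.1.1 * conj y.1.1)⁻¹ • (matEval Q x.1 * (matEval Q y.1)ᴴ)
      P := P
      Q := Q
      eq_Q := fun x y => rfl
      eq_P := fun x y => Matrix.toEuclideanLin.injective
        (LinearMap.ext fun u => (hRR x y u).symm.trans (hRR' x y u))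
      fullRank := ⟨x₀, hx₀, Matrix.rank_eq_of_mulVec_surjective hQsurj,
        Matrix.rank_eq_of_mulVec_surjective hPsurj⟩ }
  refine ⟨t, R, fun x y u => (hRR x y u).symm, fun f hf => hQinj f fun x hx => ?_, hRS, hRT⟩
  rw [← hRQ ⟨x, hx⟩, hf ⟨x, hx⟩, WithLp.ofLp_zero]

end Triple

/-! ### The unitary equivalence. -/

theorem theorem4p4 {H : Type*} [NormedAddCommGroup H] [InnerProductSpace ℂ H] [CompleteSpace H]
    (p : MvPolynomial (Fin 2) ℂ) (hp : Irreducible p) (hpt : IsInnerToral p)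
    (S T : H →L[ℂ] H) (hV : IsPureIsopair p S T)
    (M N : ℕ) (hMN : bimult S T = ((M : Cardinal), (N : Cardinal)))
    (α : ℕ) (hα : HasRank p S T α) :
    ∃ (t : AdmissibleTriple p α) (Mz Mw : t.H2 →L[ℂ] t.H2),
      t.IsMultiplicationBy Prod.fst Mz ∧ t.IsMultiplicationBy Prod.snd Mw ∧
        UnitarilyEquivalent S T Mz Mw := by
  have hS : FiniteDimensional ℂ (wandering S) := by
    apply Module.rank_lt_aleph0_iff.mp
    rw [show Module.rank ℂ (wandering S) = M from congrArg Prod.fst hMN]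
    exact Cardinal.natCast_lt_aleph0
  have hT : FiniteDimensional ℂ (wandering T) := by
    apply Module.rank_lt_aleph0_iff.mp
    rw [show Module.rank ℂ (wandering T) = N from congrArg Prod.snd hMN]
    exact Cardinal.natCast_lt_aleph0
  obtain ⟨t, R, hK, hinj, hRS, hRT⟩ := hV.exists_admissibleTriple hp hpt hα
  obtain ⟨U, hU⟩ := exists_linearIsometryEquiv_ofKernel R hK hinj
  -- Boundedness of the multiplication operators comes for free: they are the conjugates of `S` and
  -- `T` by `U`.
  let conjBy : (H →L[ℂ] H) → (t.H2 →L[ℂ] t.H2) := fun A =>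
    (U.toContinuousLinearEquiv : H →L[ℂ] t.H2) ∘L A ∘L
      (U.symm.toContinuousLinearEquiv : t.H2 →L[ℂ] H)
  have hconj : ∀ A f, conjBy A f = U (A (U.symm f)) := fun A f => rfl
  refine ⟨t, conjBy S, conjBy T, fun f x => ?_, fun f x => ?_, U, fun f => ?_, fun f => ?_⟩
  · rw [hconj, hU, hRS, ← hU, LinearIsometryEquiv.apply_symm_apply]
  · rw [hconj, hU, hRT, ← hU, LinearIsometryEquiv.apply_symm_apply]
  · rw [hconj, LinearIsometryEquiv.symm_apply_apply]
  · rw [hconj, LinearIsometryEquiv.symm_apply_apply]
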